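/- Let $(X,d)$ be a non-empty compact metric space and let $c:X\times X\to\mathbb{R}$ be continuous. For $f:X\to\mathbb{R}$ bounded below put $T^-f(x)=\inf_{y\in X}\big(f(y)+c(y,x)\big)$, and let $c[0]$ be the critical value, i.e. the unique real constant $C$ for which the equation $u=T^-u+C$ has a solution $u:X\to\mathbb{R}$ (bounded below). A critical subsolution is a function $u:X\to\mathbb{R}$ with $u(y)-u(x)\le c(x,y)+c[0]$ for all $x,y\in X$. For $n\ge 1$ let $c_n(x,y)$ be the infimum of $\sum_{i=0}^{n-1}c(x_i,x_{i+1})$ over all chains $(x_0,\dots,x_n)\in X^{n+1}$ with $x_0=x$, $x_n=y$, and let $h(x,y)=\liminf_{n\to\infty}\big(c_n(x,y)+n\,c[0]\big)$ be the Peierls barrier. A Mather measure is a Borel probability measure $\mu$ on $X\times X$ whose two marginals $\pi_{1*}\mu$ and $\pi_{2*}\mu$ coincide and for which $\int_{X\times X} c\,d\mu=-c[0]$; let $\widehat{\mathcal P}_0$ be the set of Mather measures. Let $\alpha:X\to[0,1)$ be continuous with $\int_X\alpha\,d\pi_{1*}\mu>0$ for every $\mu\in\widehat{\mathcal P}_0$.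 Let $\mathcal F_\alpha$ be the set of continuous critical subsolutions $u$ such that $\int_X\alpha(x)u(x)\,d\pi_{1*}\mu(x)\le 0$ for every $\mu\in\widehat{\mathcal P}_0$. Then for every $\lambda\in(0,1)$ there is a unique function $u_\lambda^\alpha:X\to\mathbb{R}$ (bounded below) satisfying $u_\lambda^\alpha=T^-\big((1-\lambda\alpha)u_\lambda^\alpha\big)+c[0]$, and the functions $u_\lambda^\alpha$ converge uniformly on $X$, as $\lambda\to0^+$, to a function $u_0^\alpha:X\to\mathbb{R}$. Moreover, for every $x_0\in X$, $$u_0^\alpha(x_0)=\max_{u\in\mathcal F_\alpha}u(x_0)=\min_{\mu\in\widehat{\mathcal P}_0}\frac{\int_X\alpha(x)\,h(x,x_0)\,d\pi_{1*}\mu(x)}{\int_X\alpha(x)\,d\pi_{1*}\mu(x)},$$ where both the maximum and the minimum are attained. -/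

import Mathlib

open MeasureTheory Filter Topology

namespace DiscreteWeakKAM

/-- The Lax-Oleinik operator `T⁻ f (x) = inf_y (f y + c (y, x))`.  It is only meant for
functions `f` bounded below (otherwise the infimum is `-∞`, which no real function attains);
this is why the fixed point equations below carry the requirement `BddBelow`. -/
noncomputable def laxOleinik {X : Type*} (c : X → X → ℝ) (f : X → ℝ) (x : X) : ℝ :=
  ⨅ y : X, (f y + c y x)

/-- `u` solves `u = T⁻ u + C`, the infimum in `T⁻ u` being finite. -/
def IsWeakKAMSolution {X : Type*} (c : X → X → ℝ) (C : ℝ) (u : X → ℝ) : Prop :=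
  BddBelow (Set.range u) ∧ ∀ x, u x = laxOleinik c u x + C

/-- The critical value `c[0]`: the (unique) constant `C` for which `u = T⁻ u + C` admits a
solution `u : X → ℝ`. -/
noncomputable def criticalValue {X : Type*} (c : X → X → ℝ) : ℝ :=
  Classical.epsilon fun C : ℝ => ∃ u : X → ℝ, IsWeakKAMSolution c C u

/-- Critical subsolutions: `u y - u x ≤ c (x, y) + c[0]` for all `x, y`. -/
def IsCriticalSubsolution {X : Type*} (c : X → X → ℝ) (u : X → ℝ) : Prop :=
  ∀ x y, u y - u x ≤ c x y + criticalValue c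

/-- `c_n (x, y)`: the infimum of the costs of chains `x = p 0, p 1, …, p n = y`.  Chains are
given as sequences, of which only the terms of index at most `n` matter. -/
noncomputable def chainCost {X : Type*} (c : X → X → ℝ) (n : ℕ) (x y : X) : ℝ :=
  sInf {s : ℝ | ∃ p : ℕ → X, p 0 = x ∧ p n = y ∧ s = ∑ i ∈ Finset.range n, c (p i) (p (i + 1))}

/-- The Peierls barrier `h (x, y) = liminf_n (c_n (x, y) + n c[0])`. -/
noncomputable def peierlsBarrier {X : Type*} (c : X → X → ℝ) (x y : X) : ℝ :=
  liminf (fun n : ℕ => chainCost c n x y + (n : ℝ) * criticalValue c) atTop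

/-- A closed measure: a probability measure on `X × X` with equal marginals. -/
def IsClosedMeasure {X : Type*} [MeasurableSpace X] (μ : Measure (X × X)) : Prop :=
  IsProbabilityMeasure μ ∧ μ.map Prod.fst = μ.map Prod.snd

/-- A (minimizing) Mather measure: a closed measure with `∫ c dμ = -c[0]`. -/
def IsMatherMeasure {X : Type*} [MeasurableSpace X] (c : X → X → ℝ) (μ : Measure (X × X)) :
    Prop :=
  IsClosedMeasure μ ∧ ∫ p, c p.1 p.2 ∂μ = -criticalValue c

/-- `u` solves `u = T⁻ ((1 - lam α) u) + c[0]`, the infimum in `T⁻` being finite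
(as `α` takes values in `[0, 1)` and `0 < lam < 1`, the function `(1 - lam α) u` is bounded
below if and only if `u` is). -/
def IsDiscountedSolution {X : Type*} (c : X → X → ℝ) (α : X → ℝ) (lam : ℝ) (u : X → ℝ) : Prop :=
  BddBelow (Set.range u) ∧
    ∀ x, u x = laxOleinik c (fun y => (1 - lam * α y) * u y) x + criticalValue c

/-- The set `F_α` of continuous critical subsolutions `u` with `∫ α u d(π₁ μ) ≤ 0` for every
Mather measure `μ`. -/
def constrainedSubsolutions {X : Type*} [TopologicalSpace X] [MeasurableSpace X]
    (c : X → X → ℝ) (α : X → ℝ) : Set (X → ℝ) :=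
  {u | Continuous u ∧ IsCriticalSubsolution c u ∧
    ∀ μ : Measure (X × X), IsMatherMeasure c μ → ∫ x, α x * u x ∂(μ.map Prod.fst) ≤ 0}

end DiscreteWeakKAM

/-! Duality between critical subsolutions and Mather measures drives everything. By
`exists_strict_domination`, a continuous `g` with negative integral against every Mather measure
satisfies `φ y - φ x + g (x, y) + δ ≤ t * (c x y + c[0])` for some continuous `φ`, some `t` and some
`δ > 0`. No separation theorem is used: weak KAM solutions for the costs `n (c + c[0]) - g` supply
`φ`, or else their minimizing measures accumulate at a Mather measure with `∫ g ≥ 0`.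

With `g = -α` this gives the comparison principle `IsPerturbedSolution.subsolution_le`, although `α`
may vanish on large sets; uniqueness follows. With `g = α (w - ε)` and `w ∈ F_α`, it makes `(1 - λ
t) (w - ε) + λ φ` a discounted subsolution for small `λ`, so every limit point of the `u_λ`
dominates `w`. Conversely, integrating the discounted equation against a Mather measure gives `∫ α
u_λ ≤ 0`, so limit points lie in `F_α`. Hence the only limit point is the greatest element of `F_α`,
and equicontinuity makes the convergence uniform.

For the barrier formula, `u x₀ ≤ u x + h (x, x₀)` integrated against `α` bounds `F_α` from above.
For equality, the limit `u₀` is a weak KAM solution, so its value at `x₀` is reached from an Aubry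
point `y`; there `u₀ y` is bounded below by the element `r - h (·, y)` of `F_α`, with `r` the
minimal barrier average at `y`. -/

namespace DiscreteWeakKAM

/-! ### Existence and stability for the Lax-Oleinik equation with a zeroth-order perturbation. -/

section Solutions

variable {X : Type*} [MetricSpace X] [CompactSpace X]

/-- `u` is a continuous solution of `u y = min_x ((1 - a x) u x + c (x, y)) + k`. -/
structure IsPerturbedSolution (c : X → X → ℝ) (a : X → ℝ) (k : ℝ) (u : X → ℝ) : Prop where
  continuous : Continuous u
  le : ∀ x y, u y ≤ (1 - a x) * u x + c x y + k
  exists_eq : ∀ y, ∃ x, u y = (1 - a x) * u x + c x y + k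

lemma exists_cost_modulus {c : X → X → ℝ} (hc : Continuous (Function.uncurry c)) {ε : ℝ}
    (hε : 0 < ε) : ∃ δ > 0, ∀ x x' : X, dist x x' < δ →
      (∀ z, |c z x - c z x'| < ε) ∧ ∀ z, |c x z - c x' z| < ε := by
  have huc := CompactSpace.uniformContinuous_of_continuous hc
  obtain ⟨δ, hδ, h⟩ := Metric.uniformContinuous_iff.1 huc ε hε
  refine ⟨δ, hδ, fun x x' hx => ⟨fun z => ?_, fun z => ?_⟩⟩
  · have := h (a := (z, x)) (b := (z, x')) (by simpa [Prod.dist_eq] using hx)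
    simpa [Real.dist_eq] using this
  · have := h (a := (x, z)) (b := (x', z)) (by simpa [Prod.dist_eq] using hx)
    simpa [Real.dist_eq] using this

lemma exists_abs_le_of_continuous {Y : Type*} [TopologicalSpace Y] [CompactSpace Y] {f : Y → ℝ}
    (hf : Continuous f) : ∃ M, 0 ≤ M ∧ ∀ y, |f y| ≤ M := by
  obtain ⟨M, hM⟩ := isCompact_univ.exists_bound_of_continuousOn hf.continuousOn
  exact ⟨max M 0, le_max_right _ _, fun y => (hM y trivial).trans (le_max_left _ _)⟩

lemma continuous_of_cost_modulus {c : X → X → ℝ} (hc : Continuous (Function.uncurry c))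
    {u : X → ℝ} (h : ∀ x x' ε, (∀ z, |c z x - c z x'| ≤ ε) → u x - u x' ≤ ε) :
    Continuous u := by
  refine Metric.continuous_iff.2 fun x ε hε => ?_
  obtain ⟨δ, hδ, hm⟩ := exists_cost_modulus hc (half_pos hε)
  refine ⟨δ, hδ, fun x' hx' => ?_⟩
  have h1 := h x' x (ε / 2) fun z => ((hm x' x hx').1 z).le
  have h2 := h x x' (ε / 2) fun z => by rw [abs_sub_comm]; exact ((hm x' x hx').1 z).le
  rw [Real.dist_eq, abs_lt]
  constructor <;> linarith

namespace IsPerturbedSolution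

variable {c : X → X → ℝ} {a : X → ℝ} {k : ℝ} {u : X → ℝ}

-- An optimal predecessor of `x'` also competes at `x`. The bound does not involve `a` or `k`, so
-- all solutions for the same cost are equicontinuous.
omit [CompactSpace X] in
lemma sub_le (hu : IsPerturbedSolution c a k u) {x x' : X} {ε : ℝ}
    (h : ∀ z, |c z x - c z x'| ≤ ε) : u x - u x' ≤ ε := by
  obtain ⟨z, hz⟩ := hu.exists_eq x'
  have := hu.le z x
  have := (abs_le.1 (h z)).2
  linarith

omit [CompactSpace X] in
lemma eq_laxOleinik [Nonempty X] (hu : IsPerturbedSolution c a k u) (y : X) :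
    u y = laxOleinik c (fun x => (1 - a x) * u x) y + k := by
  obtain ⟨x, hx⟩ := hu.exists_eq y
  have : laxOleinik c (fun x => (1 - a x) * u x) y = u y - k := by
    apply le_antisymm
    · refine (ciInf_le ⟨u y - k, ?_⟩ x).trans (by linarith)
      rintro _ ⟨z, rfl⟩
      have := hu.le z y
      simp only
      linarith
    · refine le_ciInf fun z => ?_
      have := hu.le z y
      linarith
  linarith

lemma bddBelow (hu : IsPerturbedSolution c a k u) : BddBelow (Set.range u) :=
  (isCompact_range hu.continuous).bddBelow

end IsPerturbedSolution

/-- A solution in terms of the Lax-Oleinik operator is continuous and the infimum is attained. -/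
theorem isPerturbedSolution_of_laxOleinik [Nonempty X] {c : X → X → ℝ}
    (hc : Continuous (Function.uncurry c)) {a : X → ℝ} (ha : Continuous a)
    (ha1 : ∀ x, a x ∈ Set.Icc (0 : ℝ) 1) {k : ℝ} {u : X → ℝ} (hu : BddBelow (Set.range u))
    (h : ∀ y, u y = laxOleinik c (fun x => (1 - a x) * u x) y + k) :
    IsPerturbedSolution c a k u := by
  obtain ⟨M, hM0, hM⟩ := exists_abs_le_of_continuous hc
  obtain ⟨m, hm⟩ := hu
  have hbdd : ∀ y, BddBelow (Set.range fun x => (1 - a x) * u x + c x y) := by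
    intro y
    refine ⟨-|m| - M, ?_⟩
    rintro _ ⟨x, rfl⟩
    have h1 : m ≤ u x := hm ⟨x, rfl⟩
    have h2 := (abs_le.1 (hM (x, y))).1
    have h3 := neg_abs_le m
    have h4 := (ha1 x).1
    have h5 := (ha1 x).2
    have h6 : -|m| ≤ (1 - a x) * u x := by
      nlinarith [mul_nonneg (sub_nonneg.2 h5) (sub_nonneg.2 (h3.trans h1)), abs_nonneg m]
    simp only [Function.uncurry] at h2 ⊢
    linarith
  have hle : ∀ x y, u y ≤ (1 - a x) * u x + c x y + k := by
    intro x y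
    rw [h y]
    have : laxOleinik c (fun x => (1 - a x) * u x) y ≤ (1 - a x) * u x + c x y :=
      ciInf_le (hbdd y) x
    linarith
  have hcont : Continuous u := by
    refine continuous_of_cost_modulus hc fun x x' ε hε => ?_
    have : u x - ε - k ≤ laxOleinik c (fun x => (1 - a x) * u x) x' := by
      refine le_ciInf fun z => ?_
      have h1 := hle z x
      have h2 := (abs_le.1 (hε z)).2
      linarith
    have := h x'
    linarith
  refine ⟨hcont, hle, fun y => ?_⟩
  have hcy : Continuous fun x => (1 - a x) * u x + c x y := by
    have : Continuous fun x => c x y := hc.comp (Continuous.prodMk_left y)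
    fun_prop
  obtain ⟨x, -, hx⟩ := isCompact_univ.exists_isMinOn Set.univ_nonempty hcy.continuousOn
  refine ⟨x, le_antisymm (hle x y) ?_⟩
  have : (1 - a x) * u x + c x y ≤ laxOleinik c (fun x => (1 - a x) * u x) y :=
    le_ciInf fun z => hx (Set.mem_univ z)
  have := h y
  linarith

/-- Perron's method: between a subsolution and a supersolution there is a solution. -/
theorem exists_isPerturbedSolution [Nonempty X] {c : X → X → ℝ}
    (hc : Continuous (Function.uncurry c)) {a : X → ℝ} (ha : Continuous a)
    (ha1 : ∀ x, a x ∈ Set.Icc (0 : ℝ) 1) {k : ℝ} {v w : X → ℝ} (hv : BddBelow (Set.range v))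
    (hvw : ∀ x, v x ≤ w x) (hvsub : ∀ x y, v y ≤ (1 - a x) * v x + c x y + k)
    (hwsup : ∀ y, ∃ x, (1 - a x) * w x + c x y + k ≤ w y) :
    ∃ u, IsPerturbedSolution c a k u ∧ ∀ x, v x ≤ u x ∧ u x ≤ w x := by
  set S : Set (X → ℝ) := {f | (∀ x, v x ≤ f x) ∧ (∀ x, f x ≤ w x) ∧
    ∀ x y, f y ≤ (1 - a x) * f x + c x y + k} with hS
  have hvS : v ∈ S := ⟨fun _ => le_rfl, hvw, hvsub⟩
  have : Nonempty S := ⟨⟨v, hvS⟩⟩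
  set u : X → ℝ := fun x => ⨆ f : S, f.1 x with hu
  have hbdd : ∀ x, BddAbove (Set.range fun f : S => f.1 x) := fun x =>
    ⟨w x, by rintro _ ⟨f, rfl⟩; exact f.2.2.1 x⟩
  have hfu : ∀ f ∈ S, ∀ x, f x ≤ u x := fun f hf x => le_ciSup (hbdd x) ⟨f, hf⟩
  have h1a : ∀ x, 0 ≤ 1 - a x := fun x => sub_nonneg.2 (ha1 x).2
  have huS : u ∈ S := by
    refine ⟨hfu v hvS, fun x => ciSup_le fun f => f.2.2.1 x, fun x y => ciSup_le fun f => ?_⟩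
    have h1 := f.2.2.2 x y
    have h2 := mul_le_mul_of_nonneg_left (hfu f f.2 x) (h1a x)
    linarith
  set u' : X → ℝ := fun y => laxOleinik c (fun x => (1 - a x) * u x) y + k with hu'
  have hle : ∀ y, u y ≤ u' y := fun y => by
    have : u y - k ≤ laxOleinik c (fun x => (1 - a x) * u x) y :=
      le_ciInf fun x => by
        have := huS.2.2 x y
        linarith
    simp only [hu']
    linarith
  have hu'le : ∀ x y, u' y ≤ (1 - a x) * u x + c x y + k := fun x y => by
    have : laxOleinik c (fun x => (1 - a x) * u x) y ≤ (1 - a x) * u x + c x y := by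
      refine ciInf_le ⟨u y - k, ?_⟩ x
      rintro _ ⟨z, rfl⟩
      have := huS.2.2 z y
      simp only
      linarith
    simp only [hu']
    linarith
  -- One more Lax-Oleinik step keeps `u` in the class, so maximality of `u` forces `u' ≤ u`.
  have hu'S : u' ∈ S := by
    refine ⟨fun x => (huS.1 x).trans (hle x), fun y => ?_, fun x y => ?_⟩
    · obtain ⟨x, hx⟩ := hwsup y
      have h1 := hu'le x y
      have h2 := mul_le_mul_of_nonneg_left (huS.2.1 x) (h1a x)
      linarith
    · have h1 := hu'le x y
      have h2 := mul_le_mul_of_nonneg_left (hle x) (h1a x)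
      linarith
  refine ⟨u, isPerturbedSolution_of_laxOleinik hc ha ha1 ?_ fun y =>
    le_antisymm (hle y) (hfu u' hu'S y), fun x => ⟨huS.1 x, huS.2.1 x⟩⟩
  obtain ⟨m, hm⟩ := hv
  refine ⟨m, ?_⟩
  rintro _ ⟨x, rfl⟩
  exact (hm ⟨x, rfl⟩).trans (huS.1 x)

/-- Solutions are stable when the perturbation tends to zero. -/
theorem exists_tendstoUniformly_of_isPerturbedSolution [Nonempty X] {c : X → X → ℝ}
    (hc : Continuous (Function.uncurry c)) {ι : Type*} (F : Ultrafilter ι) {u a : ι → X → ℝ}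
    {k : ι → ℝ} {k₀ K : ℝ} (hu : ∀ᶠ i in F, IsPerturbedSolution c (a i) (k i) (u i))
    (hK : ∀ᶠ i in F, ∀ x, |u i x| ≤ K) (ha : TendstoUniformly a 0 F)
    (hk : Tendsto k F (𝓝 k₀)) :
    ∃ v, IsPerturbedSolution c 0 k₀ v ∧ TendstoUniformly u v F := by
  -- Along an ultrafilter bounded values converge at every point, so no subsequence is extracted;
  -- equicontinuity then upgrades this to uniform convergence.
  have hlim : ∀ x, ∃ l, Tendsto (fun i => u i x) F (𝓝 l) := by
    intro x
    have hmem : Set.Icc (-K) K ∈ F.map fun i => u i x :=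
      Ultrafilter.mem_map.2 (by filter_upwards [hK] with i hi using abs_le.1 (hi x))
    obtain ⟨l, -, hl⟩ := (isCompact_Icc (a := -K) (b := K)).ultrafilter_le_nhds'
      (F.map fun i => u i x) hmem
    exact ⟨l, hl⟩
  choose v hv using hlim
  have hvmod : ∀ x x' ε, (∀ z, |c z x - c z x'| ≤ ε) → v x - v x' ≤ ε := by
    intro x x' ε h
    refine le_of_tendsto ((hv x).sub (hv x')) ?_
    filter_upwards [hu] with i hi using hi.sub_le h
  have hvcont : Continuous v := continuous_of_cost_modulus hc hvmod
  have hunif : TendstoUniformly u v F := by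
    refine Metric.tendstoUniformly_iff.2 fun ε hε => ?_
    obtain ⟨δ, hδ, hm⟩ := exists_cost_modulus hc (show 0 < ε / 4 by linarith)
    obtain ⟨t, -, ht, hcov⟩ := finite_cover_balls_of_compact (isCompact_univ (X := X)) hδ
    have hfin : ∀ᶠ i in (F : Filter ι), ∀ z ∈ t, dist (u i z) (v z) < ε / 4 :=
      (ht.eventually_all).2 fun z _ => Metric.tendsto_nhds.1 (hv z) _ (by linarith)
    filter_upwards [hfin, hu] with i hi hui x
    obtain ⟨z, hz, hxz⟩ := Set.mem_iUnion₂.1 (hcov (Set.mem_univ x))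
    have hxz' : dist x z < δ := hxz
    have h1 := hi z hz
    have m1 : ∀ y, |c y x - c y z| ≤ ε / 4 := fun y => ((hm x z hxz').1 y).le
    have m2 : ∀ y, |c y z - c y x| ≤ ε / 4 := fun y => by rw [abs_sub_comm]; exact m1 y
    have h2 := hui.sub_le m1
    have h3 := hui.sub_le m2
    have h4 := hvmod _ _ _ m1
    have h5 := hvmod _ _ _ m2
    rw [Real.dist_eq, abs_lt] at h1 ⊢
    constructor <;> linarith [h1.1, h1.2]
  have hpert : ∀ ε > 0, ∀ᶠ i in (F : Filter ι), ∀ x, |a i x * u i x| < ε := by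
    intro ε hε
    have hK1 : 0 < |K| + 1 := by positivity
    filter_upwards [hK, Metric.tendstoUniformly_iff.1 ha (ε / (|K| + 1)) (by positivity)]
      with i hi hai x
    have h1 : |a i x| < ε / (|K| + 1) := by simpa [Real.dist_eq] using hai x
    have h2 : |u i x| < |K| + 1 := lt_of_le_of_lt ((hi x).trans (le_abs_self K)) (by linarith)
    rw [abs_mul]
    calc |a i x| * |u i x| ≤ |a i x| * (|K| + 1) := by gcongr
      _ < ε := by rwa [lt_div_iff₀ hK1] at h1
  refine ⟨v, ⟨hvcont, fun x y => ?_, fun y => ?_⟩, hunif⟩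
  · refine le_of_forall_pos_lt_add fun ε hε => ?_
    have e1 := Metric.tendstoUniformly_iff.1 hunif (ε / 4) (by linarith)
    have e2 := Metric.tendsto_nhds.1 hk (ε / 4) (by linarith)
    obtain ⟨i, h1, h2, h3, h4⟩ :=
      (e1.and (e2.and ((hpert (ε / 4) (by linarith)).and hu))).exists
    have h5 := h4.le x y
    have h6 := h1 x
    have h7 := h1 y
    have h8 := h3 x
    rw [Real.dist_eq, abs_lt] at h2 h6 h7
    rw [abs_lt] at h8
    simp only [Pi.zero_apply]
    nlinarith [h2.1, h2.2, h6.1, h6.2, h7.1, h7.2, h8.1, h8.2]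
  · have hcy : Continuous fun x => v x + c x y := by
      have : Continuous fun x => c x y := hc.comp (Continuous.prodMk_left y)
      fun_prop
    obtain ⟨x, -, hx⟩ := isCompact_univ.exists_isMinOn Set.univ_nonempty hcy.continuousOn
    have hlow : v x + c x y + k₀ ≤ v y := by
      refine le_of_forall_pos_lt_add fun ε hε => ?_
      have e1 := Metric.tendstoUniformly_iff.1 hunif (ε / 4) (by linarith)
      have e2 := Metric.tendsto_nhds.1 hk (ε / 4) (by linarith)
      obtain ⟨i, h1, h2, h3, h4⟩ :=
        (e1.and (e2.and ((hpert (ε / 4) (by linarith)).and hu))).exists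
      obtain ⟨z, h5⟩ := h4.exists_eq y
      have h6 := h1 z
      have h7 := h1 y
      have h8 := h3 z
      have h9 : v x + c x y ≤ v z + c z y := hx (Set.mem_univ z)
      rw [Real.dist_eq, abs_lt] at h2 h6 h7
      rw [abs_lt] at h8
      nlinarith [h2.1, h2.2, h6.1, h6.2, h7.1, h7.2, h8.1, h8.2]
    refine ⟨x, le_antisymm ?_ (by simpa using hlow)⟩
    refine le_of_forall_pos_lt_add fun ε hε => ?_
    have e1 := Metric.tendstoUniformly_iff.1 hunif (ε / 4) (by linarith)
    have e2 := Metric.tendsto_nhds.1 hk (ε / 4) (by linarith)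
    obtain ⟨i, h1, h2, h3, h4⟩ :=
      (e1.and (e2.and ((hpert (ε / 4) (by linarith)).and hu))).exists
    have h5 := h4.le x y
    have h6 := h1 x
    have h7 := h1 y
    have h8 := h3 x
    rw [Real.dist_eq, abs_lt] at h2 h6 h7
    rw [abs_lt] at h8
    simp only [Pi.zero_apply]
    nlinarith [h2.1, h2.2, h6.1, h6.2, h7.1, h7.2, h8.1, h8.2]

/-- Every continuous cost has a continuous weak KAM solution, for some constant. -/
theorem exists_weakKAM [Nonempty X] {c : X → X → ℝ} (hc : Continuous (Function.uncurry c)) :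
    ∃ k u, IsPerturbedSolution c 0 k u := by
  obtain ⟨M, hM0, hM⟩ := exists_abs_le_of_continuous hc
  replace hM : ∀ x y, |c x y| ≤ M := fun x y => hM (x, y)
  set lam : ℕ → ℝ := fun n => 1 / ((n : ℝ) + 1) with hlam
  have hlam0 : ∀ n, 0 < lam n := fun n => by positivity
  have hlam1 : ∀ n, lam n ≤ 1 := fun n => by
    rw [hlam]
    exact div_le_one_of_le₀ (by linarith [Nat.cast_nonneg (α := ℝ) n]) (by positivity)
  -- Constant discount: the constants `±M / lam n` serve as barriers. They blow up, hence the
  -- normalization at `p` below, which turns `-(lam n * u n p)` into the additive constant.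
  have hex : ∀ n, ∃ u, IsPerturbedSolution c (fun _ => lam n) 0 u ∧
      ∀ x, -(M / lam n) ≤ u x ∧ u x ≤ M / lam n := by
    intro n
    have hmul : lam n * (M / lam n) = M := mul_div_cancel₀ M (hlam0 n).ne'
    refine exists_isPerturbedSolution hc continuous_const
      (fun _ => ⟨(hlam0 n).le, hlam1 n⟩) ⟨-(M / lam n), by rintro _ ⟨x, rfl⟩; exact le_rfl⟩
      (fun x => ?_) (fun x y => ?_) (fun y => ⟨y, ?_⟩)
    · have : 0 ≤ M / lam n := div_nonneg hM0 (hlam0 n).le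
      linarith
    · linarith [(abs_le.1 (hM x y)).1]
    · linarith [(abs_le.1 (hM y y)).2]
  choose u hu hub using hex
  obtain ⟨p⟩ := ‹Nonempty X›
  have : Nonempty X := ⟨p⟩
  have hkb : ∀ n, -(lam n * u n p) ∈ Set.Icc (-M) M := by
    intro n
    have hmul : lam n * (M / lam n) = M := mul_div_cancel₀ M (hlam0 n).ne'
    have h1 := mul_le_mul_of_nonneg_left (hub n p).1 (hlam0 n).le
    have h2 := mul_le_mul_of_nonneg_left (hub n p).2 (hlam0 n).le
    constructor <;> linarith
  obtain ⟨k, -, hk⟩ := (isCompact_Icc (a := -M) (b := M)).ultrafilter_le_nhds'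
    ((hyperfilter ℕ).map fun n => -(lam n * u n p))
    (Ultrafilter.mem_map.2 (Filter.univ_mem' hkb))
  have hsol : ∀ n, IsPerturbedSolution c (fun _ => lam n) (-(lam n * u n p))
      (fun x => u n x - u n p) := by
    intro n
    refine ⟨(hu n).continuous.sub continuous_const, fun x y => ?_, fun y => ?_⟩
    · linarith [(hu n).le x y]
    · obtain ⟨x, hx⟩ := (hu n).exists_eq y
      exact ⟨x, by linarith⟩
  have hosc : ∀ n x y, u n x - u n y ≤ 2 * M := fun n x y => (hu n).sub_le fun z =>
    (abs_sub _ _).trans (by linarith [hM z x, hM z y])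
  obtain ⟨v, hv, -⟩ := exists_tendstoUniformly_of_isPerturbedSolution hc (hyperfilter ℕ)
    (u := fun n x => u n x - u n p) (a := fun n _ => lam n) (k₀ := k) (K := 2 * M)
    (Eventually.of_forall hsol)
    (Eventually.of_forall fun n x =>
      abs_le.2 ⟨by linarith [hosc n p x], hosc n x p⟩)
    (by
      refine Metric.tendstoUniformly_iff.2 fun ε hε => ?_
      have : Tendsto lam (hyperfilter ℕ) (𝓝 0) :=
        tendsto_one_div_add_atTop_nhds_zero_nat.mono_left Nat.hyperfilter_le_atTop
      filter_upwards [Metric.tendsto_nhds.1 this ε hε] with n hn x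
      rw [dist_comm]; exact hn)
    hk
  exact ⟨k, v, hv⟩

end Solutions

/-! ### Closed measures: compactness and minimizers. -/

section Measures

lemma exists_tendsto_integral {Y : Type*} [MetricSpace Y] [CompactSpace Y] [MeasurableSpace Y]
    [BorelSpace Y] {ι : Type*} (F : Ultrafilter ι) (μ : ι → ProbabilityMeasure Y) :
    ∃ ν : ProbabilityMeasure Y, ∀ f : Y → ℝ, Continuous f →
      Tendsto (fun i => ∫ y, f y ∂(μ i : Measure Y)) F (𝓝 (∫ y, f y ∂(ν : Measure Y))) := by
  obtain ⟨ν, -, hν⟩ := isCompact_univ.ultrafilter_le_nhds' (F.map μ) Filter.univ_mem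
  refine ⟨ν, fun f hf => ?_⟩
  have h : Tendsto μ F (𝓝 ν) := hν
  exact ProbabilityMeasure.tendsto_iff_forall_integral_tendsto.1 h
    (BoundedContinuousFunction.mkOfCompact ⟨f, hf⟩)

lemma exists_probabilityMeasure_average {Y : Type*} [TopologicalSpace Y] [MeasurableSpace Y]
    [BorelSpace Y] (x : ℕ → Y) (n : ℕ) :
    ∃ μ : ProbabilityMeasure Y, ∀ f : Y → ℝ, Continuous f →
      ∫ y, f y ∂(μ : Measure Y) = (∑ i ∈ Finset.range (n + 1), f (x i)) / ((n : ℝ) + 1) := by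
  set μ : Measure Y := ((n : ENNReal) + 1)⁻¹ • ∑ i ∈ Finset.range (n + 1), Measure.dirac (x i)
    with hμ
  have hprob : IsProbabilityMeasure μ := by
    constructor
    simp only [hμ, Measure.smul_apply, Measure.finsetSum_apply, measure_univ, Finset.sum_const,
      Finset.card_range, smul_eq_mul, nsmul_eq_mul, mul_one]
    push_cast
    exact ENNReal.inv_mul_cancel (by simp) (by finiteness)
  refine ⟨⟨μ, hprob⟩, fun f hf => ?_⟩
  have hint : ∀ i, Integrable f (Measure.dirac (x i)) := fun i =>
    integrable_dirac' hf.stronglyMeasurable (by simp)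
  simp only [ProbabilityMeasure.coe_mk, hμ]
  rw [integral_smul_measure, integral_finsetSum_measure fun i _ => hint i]
  simp only [integral_dirac' f _ hf.stronglyMeasurable, ENNReal.toReal_inv, smul_eq_mul]
  rw [ENNReal.toReal_add (by finiteness) (by finiteness)]
  simp [div_eq_inv_mul]

variable {X : Type*} [MetricSpace X] [CompactSpace X] [MeasurableSpace X] [BorelSpace X]

lemma integrable_of_continuous {Y : Type*} [MetricSpace Y] [CompactSpace Y] [MeasurableSpace Y]
    [BorelSpace Y] (μ : Measure Y) [IsFiniteMeasure μ] {f : Y → ℝ} (hf : Continuous f) :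
    Integrable f μ :=
  (BoundedContinuousFunction.mkOfCompact ⟨f, hf⟩).integrable μ

omit [CompactSpace X] in
lemma integral_map_fst (μ : Measure (X × X)) {f : X → ℝ} (hf : Continuous f) :
    ∫ x, f x ∂(μ.map Prod.fst) = ∫ p, f p.1 ∂μ :=
  integral_map measurable_fst.aemeasurable hf.aestronglyMeasurable

omit [CompactSpace X] in
lemma integral_map_snd (μ : Measure (X × X)) {f : X → ℝ} (hf : Continuous f) :
    ∫ x, f x ∂(μ.map Prod.snd) = ∫ p, f p.2 ∂μ :=
  integral_map measurable_snd.aemeasurable hf.aestronglyMeasurable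

omit [CompactSpace X] in
lemma IsClosedMeasure.integral_fst_eq {μ : Measure (X × X)} (hμ : IsClosedMeasure μ) {f : X → ℝ}
    (hf : Continuous f) : ∫ p, f p.1 ∂μ = ∫ p, f p.2 ∂μ := by
  rw [← integral_map_fst μ hf, ← integral_map_snd μ hf, hμ.2]

omit [CompactSpace X] in
lemma isClosedMeasure_of_integral_eq (μ : ProbabilityMeasure (X × X))
    (h : ∀ f : X → ℝ, Continuous f →
      ∫ p, f p.1 ∂(μ : Measure (X × X)) = ∫ p, f p.2 ∂(μ : Measure (X × X))) :
    IsClosedMeasure (μ : Measure (X × X)) := by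
  refine ⟨inferInstance, ?_⟩
  have h1 : IsProbabilityMeasure ((μ : Measure (X × X)).map Prod.fst) :=
    Measure.isProbabilityMeasure_map measurable_fst.aemeasurable
  have h2 : IsProbabilityMeasure ((μ : Measure (X × X)).map Prod.snd) :=
    Measure.isProbabilityMeasure_map measurable_snd.aemeasurable
  refine ext_of_forall_integral_eq_of_IsFiniteMeasure fun f => ?_
  rw [integral_map_fst _ f.continuous, integral_map_snd _ f.continuous]
  exact h f f.continuous

/-- Closed measures form a sequentially (in fact ultrafilter) compact set. -/
lemma exists_isClosedMeasure_tendsto {ι : Type*} (F : Ultrafilter ι) {μ : ι → Measure (X × X)}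
    (hμ : ∀ i, IsClosedMeasure (μ i)) :
    ∃ ν : Measure (X × X), IsClosedMeasure ν ∧ ∀ f : X × X → ℝ, Continuous f →
      Tendsto (fun i => ∫ p, f p ∂(μ i)) F (𝓝 (∫ p, f p ∂ν)) := by
  obtain ⟨ν, hν⟩ := exists_tendsto_integral F
    (fun i => (⟨μ i, (hμ i).1⟩ : ProbabilityMeasure (X × X)))
  refine ⟨ν, isClosedMeasure_of_integral_eq ν fun f hf => ?_, hν⟩
  refine tendsto_nhds_unique (hν _ (hf.comp continuous_fst)) ?_
  refine (hν _ (hf.comp continuous_snd)).congr fun i => ?_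
  exact ((hμ i).integral_fst_eq hf).symm

/-- The coboundary `u y - u x` integrates to zero against a closed measure. -/
lemma le_integral_of_subsolution {c : X → X → ℝ} (hc : Continuous (Function.uncurry c))
    {μ : Measure (X × X)} (hμ : IsClosedMeasure μ) {u b : X → ℝ} (hu : Continuous u)
    (hb : Continuous b) {k : ℝ} (h : ∀ x y, u y - u x + b x ≤ c x y + k) :
    ∫ p, b p.1 ∂μ ≤ ∫ p, c p.1 p.2 ∂μ + k := by
  have := hμ.1
  have hi : ∀ f : X × X → ℝ, Continuous f → Integrable f μ := fun f hf =>
    integrable_of_continuous μ hf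
  have i1 := hi (fun p => u p.2) (by fun_prop)
  have i2 := hi (fun p => u p.1) (by fun_prop)
  have i12 := hi (fun p => u p.2 - u p.1) (by fun_prop)
  have i3 := hi (fun p => b p.1) (by fun_prop)
  have i4 : Integrable (fun p : X × X => c p.1 p.2) μ := hi _ hc
  have h1 : ∫ p, ((u p.2 - u p.1) + b p.1) ∂μ ≤ ∫ p, (c p.1 p.2 + k) ∂μ :=
    integral_mono (i12.add i3) (i4.add (integrable_const k)) fun p => h p.1 p.2
  rw [integral_add i12 i3, integral_sub i1 i2, integral_add i4 (integrable_const k),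
    hμ.integral_fst_eq hu] at h1
  simpa using h1

/-- A calibrated chain of a weak KAM solution produces a minimizing closed measure. -/
theorem exists_isClosedMeasure_integral_eq [Nonempty X] {c : X → X → ℝ}
    (hc : Continuous (Function.uncurry c)) {k : ℝ} {u : X → ℝ}
    (hu : IsPerturbedSolution c 0 k u) :
    ∃ μ : Measure (X × X), IsClosedMeasure μ ∧ ∫ p, c p.1 p.2 ∂μ = -k := by
  choose pre hpre using hu.exists_eq
  simp only [Pi.zero_apply, sub_zero, one_mul] at hpre
  set x : ℕ → X := fun n => pre^[n] (Classical.arbitrary X) with hx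
  have hxs : ∀ n, x (n + 1) = pre (x n) := fun n => Function.iterate_succ_apply' _ _ _
  -- The chain is built backwards through predecessors, so each transition is the pair `(x (i + 1),
  -- x i)`.
  choose μ hμ using fun n : ℕ => exists_probabilityMeasure_average (fun i => (x (i + 1), x i)) n
  obtain ⟨ν, hν⟩ := exists_tendsto_integral (hyperfilter ℕ) μ
  -- Telescoping leaves two endpoint values divided by `n + 1`: the empirical measures are
  -- asymptotically closed.
  have key : ∀ f : X → ℝ, Continuous f →
      Tendsto (fun n => ∫ p, (f p.1 - f p.2) ∂(μ n : Measure (X × X))) (hyperfilter ℕ)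
        (𝓝 0) := by
    intro f hf
    obtain ⟨M, hM0, hM⟩ := exists_abs_le_of_continuous hf
    have hb : Tendsto (fun n : ℕ => 2 * M * (1 / ((n : ℝ) + 1))) (hyperfilter ℕ) (𝓝 0) := by
      have := (tendsto_one_div_add_atTop_nhds_zero_nat (𝕜 := ℝ)).const_mul (2 * M)
      rw [mul_zero] at this
      exact this.mono_left Nat.hyperfilter_le_atTop
    refine squeeze_zero_norm (fun n => ?_) hb
    rw [hμ n (fun p => f p.1 - f p.2) (by fun_prop)]
    simp only [Finset.sum_range_sub (fun i => f (x i))]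
    rw [norm_div, mul_one_div, Real.norm_eq_abs, Real.norm_of_nonneg (by positivity)]
    gcongr
    exact (abs_sub _ _).trans (by linarith [hM (x (n + 1)), hM (x 0)])
  have hi : ∀ (f : X × X → ℝ) (_ : Continuous f) (m : ProbabilityMeasure (X × X)),
      Integrable f (m : Measure (X × X)) := fun f hf m => integrable_of_continuous _ hf
  have key2 : ∀ f : X → ℝ, Continuous f → ∫ p, (f p.1 - f p.2) ∂(ν : Measure (X × X)) = 0 :=
    fun f hf => tendsto_nhds_unique (hν (fun p => f p.1 - f p.2) (by fun_prop)) (key f hf)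
  refine ⟨ν, isClosedMeasure_of_integral_eq ν fun f hf => ?_, ?_⟩
  · have := key2 f hf
    rw [integral_sub (hi (fun p => f p.1) (by fun_prop) ν)
      (hi (fun p => f p.2) (by fun_prop) ν)] at this
    linarith
  · refine tendsto_nhds_unique (hν (fun p => c p.1 p.2) hc) ?_
    have hlim := (key u hu.continuous).neg.sub_const k
    rw [neg_zero, zero_sub] at hlim
    refine hlim.congr fun n => ?_
    rw [hμ n (fun p => c p.1 p.2) hc, hμ n (fun p => u p.1 - u p.2) (by have := hu.continuous; fun_prop)]
    have : ∀ i ∈ Finset.range (n + 1),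
        c (x (i + 1)) (x i) = u (x i) - u (x (i + 1)) - k := by
      intro i _
      have := hpre (x i)
      rw [← hxs i] at this
      linarith
    rw [Finset.sum_congr rfl this]
    simp only [Finset.sum_sub_distrib, Finset.sum_const, Finset.card_range, nsmul_eq_mul]
    push_cast
    field_simp
    ring

end Measures

/-! ### The critical value, Mather measures and strict domination. -/

section Critical

variable {X : Type*} [MetricSpace X] [CompactSpace X] [Nonempty X]

/-- `criticalValue` is an `epsilon` choice, so `exists_weakKAM` is what gives it its defining
property. -/
lemma exists_critical_solution {c : X → X → ℝ} (hc : Continuous (Function.uncurry c)) :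
    ∃ u, IsPerturbedSolution c 0 (criticalValue c) u := by
  have hex : ∃ C : ℝ, ∃ u : X → ℝ, IsWeakKAMSolution c C u := by
    obtain ⟨k, u, hu⟩ := exists_weakKAM hc
    exact ⟨k, u, hu.bddBelow, fun x => by simpa using hu.eq_laxOleinik x⟩
  obtain ⟨u, hb, hu⟩ := Classical.epsilon_spec hex
  exact ⟨u, isPerturbedSolution_of_laxOleinik hc (a := fun _ => 0) continuous_const (fun _ => by simp) hb
    fun y => by simpa [criticalValue] using hu y⟩

variable [MeasurableSpace X] [BorelSpace X]

lemma exists_isMatherMeasure {c : X → X → ℝ} (hc : Continuous (Function.uncurry c)) :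
    ∃ μ : Measure (X × X), IsMatherMeasure c μ := by
  obtain ⟨u, hu⟩ := exists_critical_solution hc
  obtain ⟨μ, h1, h2⟩ := exists_isClosedMeasure_integral_eq hc hu
  exact ⟨μ, h1, h2⟩

lemma neg_criticalValue_le_integral {c : X → X → ℝ} (hc : Continuous (Function.uncurry c))
    {μ : Measure (X × X)} (hμ : IsClosedMeasure μ) :
    -criticalValue c ≤ ∫ p, c p.1 p.2 ∂μ := by
  obtain ⟨u, hu⟩ := exists_critical_solution hc
  have := le_integral_of_subsolution hc hμ hu.continuous (b := fun _ => 0) continuous_const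
    (k := criticalValue c) fun x y => by
      have := hu.le x y
      simp only [Pi.zero_apply] at this
      linarith
  simp only [integral_zero] at this
  linarith

omit [Nonempty X] in
/-- Mather measures are compact. -/
lemma exists_isMatherMeasure_tendsto {c : X → X → ℝ} (hc : Continuous (Function.uncurry c))
    {ι : Type*} (F : Ultrafilter ι) {μ : ι → Measure (X × X)}
    (hμ : ∀ i, IsMatherMeasure c (μ i)) :
    ∃ ν : Measure (X × X), IsMatherMeasure c ν ∧ ∀ f : X × X → ℝ, Continuous f →
      Tendsto (fun i => ∫ p, f p ∂(μ i)) F (𝓝 (∫ p, f p ∂ν)) := by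
  obtain ⟨ν, h1, h2⟩ := exists_isClosedMeasure_tendsto F fun i => (hμ i).1
  refine ⟨ν, ⟨h1, ?_⟩, h2⟩
  refine tendsto_nhds_unique (h2 (fun p => c p.1 p.2) hc) ?_
  exact tendsto_const_nhds.congr fun i => (hμ i).2.symm

/-- A function of negative integral against all Mather measures is, up to a coboundary, strictly
dominated by a multiple of the critical cost. -/
theorem exists_strict_domination {c : X → X → ℝ} (hc : Continuous (Function.uncurry c))
    {g : X × X → ℝ} (hg : Continuous g)
    (h : ∀ μ : Measure (X × X), IsMatherMeasure c μ → ∫ p, g p ∂μ < 0) :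
    ∃ t δ : ℝ, 0 < δ ∧ ∃ φ : X → ℝ, Continuous φ ∧
      ∀ x y, φ y - φ x + g (x, y) + δ ≤ t * (c x y + criticalValue c) := by
  set κ := criticalValue c with hκ
  by_contra hno
  have hcost : ∀ n : ℕ, Continuous
      (Function.uncurry fun x y => (n : ℝ) * (c x y + κ) - g (x, y)) := by
    intro n
    have : Continuous fun p : X × X => c p.1 p.2 := hc
    change Continuous fun p : X × X => (n : ℝ) * (c p.1 p.2 + κ) - g (p.1, p.2)
    fun_prop
  choose k u hu using fun n : ℕ => exists_weakKAM (hcost n)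
  -- If `k n < 0`, the solution `u n` gives the domination with `t = n` and `δ = -k n`.
  have hk : ∀ n, 0 ≤ k n := by
    intro n
    by_contra hk
    refine hno ⟨n, -k n, by linarith, u n, (hu n).continuous, fun x y => ?_⟩
    have := (hu n).le x y
    simp only [Pi.zero_apply] at this
    linarith
  choose μ hμ hμk using fun n : ℕ => exists_isClosedMeasure_integral_eq (hcost n) (hu n)
  have hle : ∀ n : ℕ, (n : ℝ) * (∫ p, c p.1 p.2 ∂(μ n) + κ) ≤ ∫ p, g p ∂(μ n) := by
    intro n
    have := (hμ n).1
    have ic : Integrable (fun p : X × X => c p.1 p.2) (μ n) := integrable_of_continuous _ hc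
    have ig : Integrable g (μ n) := integrable_of_continuous _ hg
    have h1 := hμk n
    have h2 : ∫ p : X × X, ((n : ℝ) * (c p.1 p.2 + κ) - g p) ∂(μ n)
        = (n : ℝ) * (∫ p, c p.1 p.2 ∂(μ n) + κ) - ∫ p, g p ∂(μ n) := by
      have icκ : Integrable (fun p : X × X => c p.1 p.2 + κ) (μ n) := ic.add (integrable_const κ)
      rw [integral_sub (icκ.const_mul _) ig, integral_const_mul,
        integral_add ic (integrable_const κ)]
      simp
    have h3 := hk n
    simp only [Prod.mk.eta] at h1
    linarith
  have hpos : ∀ n, 0 ≤ ∫ p, c p.1 p.2 ∂(μ n) + κ := fun n => by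
    linarith [neg_criticalValue_le_integral hc (hμ n)]
  obtain ⟨ν, hν, hlim⟩ := exists_isClosedMeasure_tendsto (hyperfilter ℕ) hμ
  have hg0 : 0 ≤ ∫ p, g p ∂ν := ge_of_tendsto' (hlim g hg) fun n =>
    (mul_nonneg (Nat.cast_nonneg n) (hpos n)).trans (hle n)
  refine absurd (h ν ⟨hν, ?_⟩) (not_lt.2 hg0)
  -- The excess cost times `n` is at most `∫ g`, hence bounded, so the limit measure is a Mather
  -- measure.
  have hc0 : Tendsto (fun n => ∫ p, c p.1 p.2 ∂(μ n) + κ) (hyperfilter ℕ) (𝓝 0) := by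
    obtain ⟨M, hM0, hM⟩ := exists_abs_le_of_continuous hg
    have hb : Tendsto (fun n : ℕ => M / (n : ℝ)) (hyperfilter ℕ) (𝓝 0) :=
      (tendsto_const_div_atTop_nhds_zero_nat M).mono_left Nat.hyperfilter_le_atTop
    refine squeeze_zero' (Eventually.of_forall hpos) ?_ hb
    have hev : ∀ᶠ n : ℕ in hyperfilter ℕ, 0 < n :=
      Nat.hyperfilter_le_atTop (eventually_gt_atTop 0)
    filter_upwards [hev] with n hn
    have hn' : (0 : ℝ) < n := Nat.cast_pos.2 hn
    have := (hμ n).1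
    have h1 : ∫ p, g p ∂(μ n) ≤ ∫ _, M ∂(μ n) :=
      integral_mono (integrable_of_continuous _ hg) (integrable_const M)
        fun p => (le_abs_self _).trans (hM p)
    simp only [integral_const, probReal_univ, smul_eq_mul, one_mul] at h1
    rw [le_div_iff₀ hn', mul_comm]
    exact (hle n).trans h1
  have := tendsto_nhds_unique ((hlim (fun p => c p.1 p.2) hc).add_const κ) hc0
  linarith

end Critical

/-! ### Discounted equations: uniqueness and the vanishing discount limit. -/

section Discounted

variable {X : Type*} [MetricSpace X] [CompactSpace X] [Nonempty X]
  {c : X → X → ℝ} {α : X → ℝ} {lam : ℝ} {u : X → ℝ}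

lemma IsDiscountedSolution.isPerturbedSolution (hc : Continuous (Function.uncurry c))
    (hα : Continuous α) (hα1 : ∀ x, α x ∈ Set.Ico (0 : ℝ) 1) (hlam : lam ∈ Set.Ioo (0 : ℝ) 1)
    (hu : IsDiscountedSolution c α lam u) :
    IsPerturbedSolution c (fun x => lam * α x) (criticalValue c) u :=
  isPerturbedSolution_of_laxOleinik hc (by fun_prop)
    (fun x => ⟨mul_nonneg hlam.1.le (hα1 x).1,
      mul_le_one₀ hlam.2.le (hα1 x).1 (hα1 x).2.le⟩) hu.1 hu.2

lemma IsPerturbedSolution.isDiscountedSolution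
    (hu : IsPerturbedSolution c (fun x => lam * α x) (criticalValue c) u) :
    IsDiscountedSolution c α lam u :=
  ⟨hu.bddBelow, hu.eq_laxOleinik⟩

/-- Solutions of the discounted equations exist, with a bound uniform in the discount. -/
theorem exists_discounted_solution (hc : Continuous (Function.uncurry c))
    (hα : Continuous α) (hα1 : ∀ x, α x ∈ Set.Ico (0 : ℝ) 1) :
    ∃ K, ∀ lam ∈ Set.Ioo (0 : ℝ) 1, ∃ u,
      IsPerturbedSolution c (fun x => lam * α x) (criticalValue c) u ∧ ∀ x, |u x| ≤ K := by
  obtain ⟨v, hv⟩ := exists_critical_solution hc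
  obtain ⟨K, hK0, hK⟩ := exists_abs_le_of_continuous hv.continuous
  refine ⟨2 * K, fun lam hlam => ?_⟩
  have hK' := fun x => abs_le.1 (hK x)
  have hla : ∀ x, 0 ≤ lam * α x := fun x => mul_nonneg hlam.1.le (hα1 x).1
  -- Shifting a critical solution by `∓K` makes it nonpositive or nonnegative; the factor `1 - lam *
  -- α` then raises the former and lowers the latter, giving a sub- and a supersolution.
  obtain ⟨u, hu, hub⟩ := exists_isPerturbedSolution hc (a := fun x => lam * α x) (by fun_prop)
    (fun x => ⟨hla x, mul_le_one₀ hlam.2.le (hα1 x).1 (hα1 x).2.le⟩)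
    (k := criticalValue c) (v := fun x => v x - K) (w := fun x => v x + K)
    ⟨-(2 * K), by
      rintro _ ⟨x, rfl⟩
      have := (hK' x).1
      simp only
      linarith⟩
    (fun x => by linarith)
    (fun x y => by
      have h1 := hv.le x y
      have h2 := mul_nonneg (hla x) (sub_nonneg.2 (hK' x).2)
      simp only [Pi.zero_apply] at h1
      nlinarith)
    (fun y => by
      obtain ⟨x, hx⟩ := hv.exists_eq y
      refine ⟨x, ?_⟩
      have h2 := mul_nonneg (hla x) (show 0 ≤ v x + K by linarith [(hK' x).1])
      simp only [Pi.zero_apply] at hx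
      nlinarith)
  exact ⟨u, hu, fun x => abs_le.2 ⟨by linarith [(hub x).1, (hK' x).1],
    by linarith [(hub x).2, (hK' x).2]⟩⟩

variable [MeasurableSpace X] [BorelSpace X]

/-- Comparison principle for the discounted equation. -/
theorem IsPerturbedSolution.subsolution_le (hc : Continuous (Function.uncurry c))
    (hα : Continuous α) (hα1 : ∀ x, α x ∈ Set.Ico (0 : ℝ) 1)
    (hα_pos : ∀ μ : Measure (X × X), IsMatherMeasure c μ → 0 < ∫ x, α x ∂(μ.map Prod.fst))
    (hlam : lam ∈ Set.Ioo (0 : ℝ) 1)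
    (hu : IsPerturbedSolution c (fun x => lam * α x) (criticalValue c) u) {w : X → ℝ}
    (hw : Continuous w)
    (hwsub : ∀ x y, w y ≤ (1 - lam * α x) * w x + c x y + criticalValue c) (x : X) :
    w x ≤ u x := by
  have huc := hu.continuous
  obtain ⟨t, δ, hδ, φ, hφ, hdom⟩ := exists_strict_domination hc (g := fun p => -α p.1)
    (by fun_prop) fun μ hμ => by
      have := hα_pos μ hμ
      rw [integral_map_fst μ hα] at this
      rw [integral_neg]
      linarith
  have hd : Continuous fun x => w x - u x := by fun_prop
  obtain ⟨z, -, hz⟩ := isCompact_univ.exists_isMaxOn Set.univ_nonempty hd.continuousOn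
  have hz : ∀ y, w y - u y ≤ w z - u z := fun y => hz (Set.mem_univ y)
  by_contra! hx
  have hm : 0 < w z - u z := lt_of_lt_of_le (by linarith) (hz x)
  have hS : IsCompact {y | w y - u y = w z - u z} :=
    (isClosed_eq hd continuous_const).isCompact
  have hψ : Continuous fun y => φ y - t * u y := by fun_prop
  -- A second maximization, inside the set where `w - u` is maximal. The optimal predecessor `x'` of
  -- `y` stays in that set and has `α x' = 0`; strict domination then makes `φ - t * u` larger at
  -- `x'` by at least `δ`.
  obtain ⟨y, hyS, hy⟩ := hS.exists_isMaxOn ⟨z, rfl⟩ hψ.continuousOn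
  obtain ⟨x', hx'⟩ := hu.exists_eq y
  have h1 := hwsub x' y
  have hyS' : w y - u y = w z - u z := hyS
  have ha : 0 ≤ lam * α x' := mul_nonneg hlam.1.le (hα1 x').1
  have ha1 : lam * α x' < 1 := mul_lt_one_of_nonneg_of_lt_one_left hlam.1.le hlam.2 (hα1 x').2.le
  have h2 : w z - u z ≤ (1 - lam * α x') * (w x' - u x') := by linarith
  have h3 : (1 - lam * α x') * (w x' - u x') ≤ (1 - lam * α x') * (w z - u z) :=
    mul_le_mul_of_nonneg_left (hz x') (by linarith)
  have h4 : lam * α x' = 0 := by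
    refine le_antisymm ?_ ha
    by_contra! h
    nlinarith [mul_pos h hm]
  have hα0 : α x' = 0 := (mul_eq_zero.1 h4).resolve_left hlam.1.ne'
  rw [h4, sub_zero, one_mul] at h2
  have hx'S : w x' - u x' = w z - u z := le_antisymm (hz x') h2
  have h5 : φ x' - t * u x' ≤ φ y - t * u y := hy hx'S
  have h6 := hdom x' y
  simp only [h4, sub_zero, one_mul] at hx'
  have h7 : c x' y + criticalValue c = u y - u x' := by linarith
  rw [h7, hα0] at h6
  linarith

theorem IsDiscountedSolution.unique (hc : Continuous (Function.uncurry c))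
    (hα : Continuous α) (hα1 : ∀ x, α x ∈ Set.Ico (0 : ℝ) 1)
    (hα_pos : ∀ μ : Measure (X × X), IsMatherMeasure c μ → 0 < ∫ x, α x ∂(μ.map Prod.fst))
    (hlam : lam ∈ Set.Ioo (0 : ℝ) 1) {v : X → ℝ}
    (hu : IsDiscountedSolution c α lam u) (hv : IsDiscountedSolution c α lam v) : u = v := by
  have hu' := hu.isPerturbedSolution hc hα hα1 hlam
  have hv' := hv.isPerturbedSolution hc hα hα1 hlam
  exact funext fun x => le_antisymm
    (hv'.subsolution_le hc hα hα1 hα_pos hlam hu'.continuous hu'.le x)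
    (hu'.subsolution_le hc hα hα1 hα_pos hlam hv'.continuous hv'.le x)

-- The equation reads `u y - u x + lam * α x * u x ≤ c x y + c[0]`, whose right side has integral
-- zero against a Mather measure.
omit [Nonempty X] in
lemma IsPerturbedSolution.integral_discount_nonpos (hc : Continuous (Function.uncurry c))
    (hα : Continuous α) (hlam : 0 < lam)
    (hu : IsPerturbedSolution c (fun x => lam * α x) (criticalValue c) u)
    {μ : Measure (X × X)} (hμ : IsMatherMeasure c μ) :
    ∫ p, α p.1 * u p.1 ∂μ ≤ 0 := by
  have huc := hu.continuous
  have h := le_integral_of_subsolution hc hμ.1 huc (b := fun x => lam * (α x * u x))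
    (by fun_prop) (k := criticalValue c) fun x y => by linarith [hu.le x y]
  rw [integral_const_mul, hμ.2] at h
  by_contra! h'
  nlinarith [mul_pos hlam h']

/-- For small discounts, constrained critical subsolutions nearly bound discounted solutions from
below. -/
theorem exists_discounted_subsolution (hc : Continuous (Function.uncurry c))
    (hα : Continuous α) (hα1 : ∀ x, α x ∈ Set.Ico (0 : ℝ) 1)
    (hα_pos : ∀ μ : Measure (X × X), IsMatherMeasure c μ → 0 < ∫ x, α x ∂(μ.map Prod.fst))
    {w : X → ℝ} (hw : w ∈ constrainedSubsolutions c α) {ε : ℝ} (hε : 0 < ε) :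
    ∃ t, ∃ φ : X → ℝ, Continuous φ ∧ ∀ᶠ lam in 𝓝[>] (0 : ℝ), ∀ u,
      IsPerturbedSolution c (fun x => lam * α x) (criticalValue c) u →
        ∀ x, (1 - lam * t) * (w x - ε) + lam * φ x ≤ u x := by
  obtain ⟨hwc, hwsub, hwint⟩ := hw
  obtain ⟨t, δ, hδ, φ, hφ, hdom⟩ := exists_strict_domination hc
    (g := fun p => α p.1 * (w p.1 - ε)) (by fun_prop) fun μ hμ => by
      have h1 := hα_pos μ hμ
      have h2 := hwint μ hμ
      have := hμ.1.1
      rw [integral_map_fst μ hα] at h1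
      rw [integral_map_fst μ (f := fun x => α x * w x) (by fun_prop)] at h2
      have i1 : Integrable (fun p : X × X => α p.1 * w p.1) μ :=
        integrable_of_continuous μ (by fun_prop)
      have i2 : Integrable (fun p : X × X => α p.1 * ε) μ :=
        integrable_of_continuous μ (by fun_prop)
      simp only [mul_sub]
      rw [integral_sub i1 i2, integral_mul_const]
      nlinarith [mul_pos h1 hε]
  refine ⟨t, φ, hφ, ?_⟩
  -- The candidate differs from `w - ε` by `lam * (φ - t * (w - ε))`, so the discount term creates
  -- an error at most `lam ^ 2 * B`, absorbed by the gain `lam * δ`.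
  obtain ⟨B, hB0, hB⟩ := exists_abs_le_of_continuous
    (f := fun x => α x * (φ x - t * (w x - ε))) (by fun_prop)
  have e1 : ∀ᶠ lam in 𝓝[>] (0 : ℝ), lam ∈ Set.Ioo (0 : ℝ) 1 := Ioo_mem_nhdsGT one_pos
  have e2 : ∀ᶠ lam in 𝓝[>] (0 : ℝ), lam * t < 1 := by
    have : Tendsto (fun lam : ℝ => lam * t) (𝓝[>] 0) (𝓝 (0 * t)) :=
      ((continuous_id.mul continuous_const).tendsto 0).mono_left nhdsWithin_le_nhds
    rw [zero_mul] at this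
    exact this.eventually (gt_mem_nhds one_pos)
  have e3 : ∀ᶠ lam in 𝓝[>] (0 : ℝ), lam * B < δ := by
    have : Tendsto (fun lam : ℝ => lam * B) (𝓝[>] 0) (𝓝 (0 * B)) :=
      ((continuous_id.mul continuous_const).tendsto 0).mono_left nhdsWithin_le_nhds
    rw [zero_mul] at this
    exact this.eventually (gt_mem_nhds hδ)
  filter_upwards [e1, e2, e3] with lam h1 h2 h3 u hu
  refine hu.subsolution_le hc hα hα1 hα_pos h1
    (w := fun x => (1 - lam * t) * (w x - ε) + lam * φ x) (by fun_prop) fun x y => ?_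
  have s1 := mul_le_mul_of_nonneg_left (hwsub x y) (sub_nonneg.2 h2.le)
  have s2 := mul_le_mul_of_nonneg_left (hdom x y) h1.1.le
  have s3 := mul_le_mul_of_nonneg_left (h3.le) h1.1.le
  have s4 := mul_le_mul_of_nonneg_left (abs_le.1 (hB x)).2 (mul_nonneg h1.1.le h1.1.le)
  simp only at s2
  nlinarith

/-- Limit points of discounted solutions are the largest constrained subsolutions. -/
theorem exists_limit_discounted_solutions (hc : Continuous (Function.uncurry c))
    (hα : Continuous α) (hα1 : ∀ x, α x ∈ Set.Ico (0 : ℝ) 1)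
    (hα_pos : ∀ μ : Measure (X × X), IsMatherMeasure c μ → 0 < ∫ x, α x ∂(μ.map Prod.fst))
    {u : ℝ → X → ℝ} (hu : ∀ lam ∈ Set.Ioo (0 : ℝ) 1, IsDiscountedSolution c α lam (u lam))
    (F : Ultrafilter ℝ) (hF : F ≤ 𝓝[>] (0 : ℝ)) :
    ∃ v, IsPerturbedSolution c 0 (criticalValue c) v ∧ v ∈ constrainedSubsolutions c α ∧
      (∀ w ∈ constrainedSubsolutions c α, ∀ x, w x ≤ v x) ∧ TendstoUniformly u v F := by
  have hF01 : ∀ᶠ lam in (F : Filter ℝ), lam ∈ Set.Ioo (0 : ℝ) 1 := hF (Ioo_mem_nhdsGT one_pos)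
  have hF0 : Tendsto (fun lam : ℝ => lam) F (𝓝 0) := hF.trans nhdsWithin_le_nhds
  have hsol : ∀ᶠ lam in (F : Filter ℝ),
      IsPerturbedSolution c (fun x => lam * α x) (criticalValue c) (u lam) := by
    filter_upwards [hF01] with lam h using (hu lam h).isPerturbedSolution hc hα hα1 h
  obtain ⟨K, hK⟩ := exists_discounted_solution hc hα hα1
  obtain ⟨v, hv, hlim⟩ := exists_tendstoUniformly_of_isPerturbedSolution hc F (u := u) (K := K)
    hsol
    (by
      -- Uniqueness transfers the uniform bound of the constructed solutions to the given ones.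
      filter_upwards [hF01] with lam h
      obtain ⟨u', hu', hb⟩ := hK lam h
      rwa [(hu lam h).unique hc hα hα1 hα_pos h hu'.isDiscountedSolution])
    (by
      refine Metric.tendstoUniformly_iff.2 fun ε hε => ?_
      filter_upwards [hF01, hF0.eventually (gt_mem_nhds hε)] with lam h1 h2 x
      have h3 := mul_nonneg h1.1.le (hα1 x).1
      rw [Pi.zero_apply, dist_comm, Real.dist_eq, sub_zero, abs_of_nonneg h3]
      exact (mul_le_of_le_one_right h1.1.le (hα1 x).2.le).trans_lt h2)
    tendsto_const_nhds
  have hpt : ∀ x, Tendsto (fun lam => u lam x) F (𝓝 (v x)) := fun x => hlim.tendsto_at x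
  have hvc := hv.continuous
  refine ⟨v, hv, ⟨hvc, fun x y => ?_, fun μ hμ => ?_⟩, fun w hw x => ?_, hlim⟩
  · have := hv.le x y
    simp only [Pi.zero_apply] at this
    linarith
  · rw [integral_map_fst μ (f := fun x => α x * v x) (by fun_prop)]
    have := hμ.1.1
    refine le_of_forall_pos_le_add fun ε hε => ?_
    obtain ⟨lam, h1, h2, h3⟩ :=
      (hF01.and (hsol.and (Metric.tendstoUniformly_iff.1 hlim ε hε))).exists
    have hulc := h2.continuous
    have h4 := h2.integral_discount_nonpos hc hα h1.1 hμ
    have h5 : ∫ p, α p.1 * v p.1 ∂μ ≤ ∫ p, (α p.1 * u lam p.1 + ε) ∂μ := by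
      refine integral_mono (integrable_of_continuous μ (by fun_prop))
        (integrable_of_continuous μ (by fun_prop)) fun p => ?_
      have h6 := h3 p.1
      rw [Real.dist_eq] at h6
      have h7 := (abs_lt.1 h6).2
      have h8 := hα1 p.1
      simp only
      nlinarith [mul_le_mul_of_nonneg_left h7.le h8.1, mul_le_mul_of_nonneg_right h8.2.le hε.le]
    have h9 : ∫ p, (α p.1 * u lam p.1 + ε) ∂μ = ∫ p, α p.1 * u lam p.1 ∂μ + ε := by
      rw [integral_add (integrable_of_continuous μ (by fun_prop)) (integrable_const ε)]
      simp
    linarith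
  · refine le_of_forall_pos_le_add fun ε hε => ?_
    obtain ⟨t, φ, hφ, hev⟩ := exists_discounted_subsolution hc hα hα1 hα_pos hw hε
    have hl : Tendsto (fun lam : ℝ => (1 - lam * t) * (w x - ε) + lam * φ x) F
        (𝓝 ((1 - 0 * t) * (w x - ε) + 0 * φ x)) :=
      (((hF0.mul_const t).const_sub 1).mul_const _).add (hF0.mul_const _)
    have : (1 - 0 * t) * (w x - ε) + 0 * φ x ≤ v x := by
      refine le_of_tendsto_of_tendsto hl (hpt x) ?_
      filter_upwards [hF hev, hsol] with lam h1 h2 using h1 _ h2 x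
    linarith

/-- The discounted solutions converge uniformly to the largest constrained subsolution. -/
theorem exists_tendstoUniformly_discounted (hc : Continuous (Function.uncurry c))
    (hα : Continuous α) (hα1 : ∀ x, α x ∈ Set.Ico (0 : ℝ) 1)
    (hα_pos : ∀ μ : Measure (X × X), IsMatherMeasure c μ → 0 < ∫ x, α x ∂(μ.map Prod.fst)) :
    ∃ v, IsPerturbedSolution c 0 (criticalValue c) v ∧ v ∈ constrainedSubsolutions c α ∧
      (∀ w ∈ constrainedSubsolutions c α, ∀ x, w x ≤ v x) ∧
      ∀ u : ℝ → X → ℝ, (∀ lam ∈ Set.Ioo (0 : ℝ) 1, IsDiscountedSolution c α lam (u lam)) →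
        TendstoUniformly u v (𝓝[>] (0 : ℝ)) := by
  obtain ⟨K, hK⟩ := exists_discounted_solution hc hα hα1
  have hex : ∀ lam, ∃ u, lam ∈ Set.Ioo (0 : ℝ) 1 → IsDiscountedSolution c α lam u := by
    intro lam
    by_cases h : lam ∈ Set.Ioo (0 : ℝ) 1
    · obtain ⟨u, hu, -⟩ := hK lam h
      exact ⟨u, fun _ => hu.isDiscountedSolution⟩
    · exact ⟨0, fun h' => absurd h' h⟩
  choose U hU using hex
  obtain ⟨v, hv, hvF, hmax, -⟩ := exists_limit_discounted_solutions hc hα hα1 hα_pos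
    (u := U) hU (Ultrafilter.of (𝓝[>] 0)) (Ultrafilter.of_le _)
  refine ⟨v, hv, hvF, hmax, fun u hu => ?_⟩
  -- Convergence is tested on ultrafilters: each limit is a greatest element of `F_α`, hence equal
  -- to `v`.
  refine fun s hs => mem_iff_ultrafilter.2 fun F hF => ?_
  obtain ⟨v', -, hvF', hmax', hlim⟩ := exists_limit_discounted_solutions hc hα hα1 hα_pos hu F hF
  have : v' = v := funext fun x => le_antisymm (hmax v' hvF' x) (hmax' v hvF x)
  subst this
  exact hlim s hs

end Discounted

/-! ### Chains, the Peierls barrier and Aubry points. -/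

section Peierls

variable {X : Type*} {c : X → X → ℝ}

/-- The critical cost of the chain `p 0, …, p n`. -/
noncomputable def pathCost (c : X → X → ℝ) (p : ℕ → X) (n : ℕ) : ℝ :=
  ∑ i ∈ Finset.range n, (c (p i) (p (i + 1)) + criticalValue c)

lemma pathCost_eq (c : X → X → ℝ) (p : ℕ → X) (n : ℕ) :
    pathCost c p n = ∑ i ∈ Finset.range n, c (p i) (p (i + 1)) + n * criticalValue c := by
  simp [pathCost, Finset.sum_add_distrib]

lemma exists_path_append (c : X → X → ℝ) {p q : ℕ → X} {m n : ℕ} (h : p m = q 0) :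
    ∃ r : ℕ → X, r 0 = p 0 ∧ r (m + n) = q n ∧
      pathCost c r (m + n) = pathCost c p m + pathCost c q n := by
  have hlt : ∀ i ≤ m, (if i < m then p i else q (i - m)) = p i := by
    intro i hi
    split_ifs with h'
    · rfl
    · obtain rfl : i = m := by omega
      simp [h]
  refine ⟨fun i => if i < m then p i else q (i - m), hlt 0 (Nat.zero_le m), by simp, ?_⟩
  rw [pathCost, Finset.sum_range_add]
  congr 1
  · refine Finset.sum_congr rfl fun i hi => ?_
    have := Finset.mem_range.1 hi
    rw [hlt i this.le, hlt (i + 1) this]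
  · refine Finset.sum_congr rfl fun i _ => ?_
    simp [add_assoc]

lemma IsCriticalSubsolution.sub_le_pathCost {u : X → ℝ} (hu : IsCriticalSubsolution c u)
    (p : ℕ → X) (n : ℕ) : u (p n) - u (p 0) ≤ pathCost c p n := by
  rw [← Finset.sum_range_sub (fun i => u (p i))]
  exact Finset.sum_le_sum fun i _ => hu _ _

/-- A calibrated sequence runs backwards in time; reversed, its cost telescopes. -/
lemma exists_path_of_calibrated {u : X → ℝ} {x : ℕ → X}
    (hx : ∀ n, u (x n) = u (x (n + 1)) + c (x (n + 1)) (x n) + criticalValue c) (i n : ℕ) :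
    ∃ p : ℕ → X, p 0 = x (i + n) ∧ p n = x i ∧ pathCost c p n = u (x i) - u (x (i + n)) := by
  refine ⟨fun k => x (i + n - k), by simp, by simp, ?_⟩
  have : ∀ k ∈ Finset.range n, c (x (i + n - k)) (x (i + n - (k + 1))) + criticalValue c =
      u (x (i + n - (k + 1))) - u (x (i + n - k)) := by
    intro k hk
    have hk := Finset.mem_range.1 hk
    have h1 : i + n - k = i + n - (k + 1) + 1 := by omega
    rw [h1]
    linarith [hx (i + n - (k + 1))]
  rw [pathCost, Finset.sum_congr rfl this, Finset.sum_range_sub (fun k => u (x (i + n - k)))]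
  simp

variable [MetricSpace X] [CompactSpace X]

/-- Only the first transition sees the starting point, so `δ` does not depend on the length of the
chain. -/
lemma exists_path_change_start (hc : Continuous (Function.uncurry c)) {ε : ℝ} (hε : 0 < ε) :
    ∃ δ > 0, ∀ x x' : X, dist x x' < δ → ∀ (p : ℕ → X) (n : ℕ), 0 < n → p 0 = x' →
      ∃ q : ℕ → X, q 0 = x ∧ q n = p n ∧ pathCost c q n ≤ pathCost c p n + ε := by
  obtain ⟨δ, hδ, h⟩ := exists_cost_modulus hc hε
  refine ⟨δ, hδ, fun x x' hx p n hn hp => ⟨Function.update p 0 x, by simp, by simp [hn.ne'], ?_⟩⟩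
  obtain ⟨m, rfl⟩ := Nat.exists_eq_succ_of_ne_zero hn.ne'
  have h1 := (abs_lt.1 ((h x x' hx).2 (p 1))).2
  simp only [pathCost, Nat.succ_eq_add_one, Finset.sum_range_succ' _ m]
  simp only [ne_eq, Nat.add_eq_zero_iff, one_ne_zero, and_false, not_false_eq_true,
    Function.update_of_ne, zero_add, Function.update_self, hp]
  linarith

lemma exists_path_change_end (hc : Continuous (Function.uncurry c)) {ε : ℝ} (hε : 0 < ε) :
    ∃ δ > 0, ∀ y y' : X, dist y y' < δ → ∀ (p : ℕ → X) (n : ℕ), 0 < n → p n = y' →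
      ∃ q : ℕ → X, q 0 = p 0 ∧ q n = y ∧ pathCost c q n ≤ pathCost c p n + ε := by
  obtain ⟨δ, hδ, h⟩ := exists_cost_modulus hc hε
  refine ⟨δ, hδ, fun y y' hy p n hn hp => ⟨Function.update p n y, by simp [hn.ne], by simp, ?_⟩⟩
  obtain ⟨m, rfl⟩ := Nat.exists_eq_succ_of_ne_zero hn.ne'
  have h1 := (abs_lt.1 ((h y y' hy).1 (p m))).2
  have h2 : ∀ i ∈ Finset.range m,
      c (Function.update p (m + 1) y i) (Function.update p (m + 1) y (i + 1)) + criticalValue c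
        = c (p i) (p (i + 1)) + criticalValue c := by
    intro i hi
    have hi := Finset.mem_range.1 hi
    rw [Function.update_of_ne (by omega), Function.update_of_ne (by omega)]
  simp only [Nat.succ_eq_add_one] at hp
  simp only [pathCost, Nat.succ_eq_add_one, Finset.sum_range_succ _ m]
  rw [Finset.sum_congr rfl h2, Function.update_self, Function.update_of_ne (by omega), hp]
  linarith

variable [Nonempty X]

lemma exists_isCriticalSubsolution (hc : Continuous (Function.uncurry c)) :
    ∃ u, Continuous u ∧ IsCriticalSubsolution c u := by
  obtain ⟨u, hu⟩ := exists_critical_solution hc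
  refine ⟨u, hu.continuous, fun x y => ?_⟩
  have := hu.le x y
  simp only [Pi.zero_apply] at this
  linarith

lemma chainCost_le_pathCost (hc : Continuous (Function.uncurry c)) (p : ℕ → X) (n : ℕ) :
    chainCost c n (p 0) (p n) + n * criticalValue c ≤ pathCost c p n := by
  obtain ⟨u, -, hu⟩ := exists_isCriticalSubsolution hc
  rw [pathCost_eq]
  gcongr
  refine csInf_le ⟨u (p n) - u (p 0) - n * criticalValue c, ?_⟩ ⟨p, rfl, rfl, rfl⟩
  rintro _ ⟨q, h0, hn, rfl⟩
  have := hu.sub_le_pathCost q n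
  rw [pathCost_eq, h0, hn] at this
  linarith

-- For `n = 0` and `x ≠ y` there is no chain and `chainCost` takes the default value `0`; positive
-- lengths suffice for the liminf.
omit [MetricSpace X] [CompactSpace X] [Nonempty X] in
lemma chainCost_set_nonempty (c : X → X → ℝ) {n : ℕ} (hn : 0 < n) (x y : X) :
    {s : ℝ | ∃ p : ℕ → X, p 0 = x ∧ p n = y ∧
      s = ∑ i ∈ Finset.range n, c (p i) (p (i + 1))}.Nonempty :=
  ⟨_, fun i => if i = 0 then x else y, by simp, by simp [hn.ne'], rfl⟩

omit [MetricSpace X] [CompactSpace X] [Nonempty X] in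
lemma exists_pathCost_lt {n : ℕ} (hn : 0 < n) {x y : X} {a : ℝ}
    (h : chainCost c n x y + n * criticalValue c < a) :
    ∃ p : ℕ → X, p 0 = x ∧ p n = y ∧ pathCost c p n < a := by
  obtain ⟨_, ⟨p, h0, h1, rfl⟩, hlt⟩ := exists_lt_of_csInf_lt (chainCost_set_nonempty c hn x y)
    (show chainCost c n x y < a - n * criticalValue c by linarith)
  exact ⟨p, h0, h1, by rw [pathCost_eq]; linarith⟩

omit [MetricSpace X] [CompactSpace X] [Nonempty X] in
lemma IsCriticalSubsolution.sub_le_chainCost {u : X → ℝ} (hu : IsCriticalSubsolution c u)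
    {n : ℕ} (hn : 0 < n) (x y : X) : u y - u x ≤ chainCost c n x y + n * criticalValue c := by
  by_contra! h
  obtain ⟨p, rfl, rfl, hp⟩ := exists_pathCost_lt hn h
  exact absurd (hu.sub_le_pathCost p n) (not_le.2 hp)

lemma isBoundedUnder_ge_chainCost (hc : Continuous (Function.uncurry c)) (x y : X) :
    IsBoundedUnder (· ≥ ·) atTop
      fun n : ℕ => chainCost c n x y + (n : ℝ) * criticalValue c := by
  obtain ⟨u, -, hu⟩ := exists_isCriticalSubsolution hc
  refine ⟨u y - u x, eventually_map.2 ?_⟩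
  filter_upwards [eventually_gt_atTop 0] with n hn using hu.sub_le_chainCost hn x y

omit [CompactSpace X] [Nonempty X] in
lemma exists_calibrated {u : X → ℝ} (hu : IsPerturbedSolution c 0 (criticalValue c) u) (x₀ : X) :
    ∃ x : ℕ → X, x 0 = x₀ ∧
      ∀ n, u (x n) = u (x (n + 1)) + c (x (n + 1)) (x n) + criticalValue c := by
  choose pre hpre using hu.exists_eq
  simp only [Pi.zero_apply, sub_zero, one_mul] at hpre
  refine ⟨fun n => pre^[n] x₀, rfl, fun n => ?_⟩
  simp only [Function.iterate_succ_apply']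
  exact hpre _

/-- Jumping from `x` in one step onto a calibrated chain ending at `y` bounds the costs above
uniformly in the length, so the real `liminf` is not a default value. -/
lemma isCoboundedUnder_ge_chainCost (hc : Continuous (Function.uncurry c)) (x y : X) :
    IsCoboundedUnder (· ≥ ·) atTop
      fun n : ℕ => chainCost c n x y + (n : ℝ) * criticalValue c := by
  obtain ⟨u, hu⟩ := exists_critical_solution hc
  obtain ⟨K, hK0, hK⟩ := exists_abs_le_of_continuous hu.continuous
  obtain ⟨M, hM0, hM⟩ := exists_abs_le_of_continuous hc
  obtain ⟨z, hz0, hz⟩ := exists_calibrated hu y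
  refine IsBoundedUnder.isCoboundedUnder_ge ⟨M + criticalValue c + 2 * K, eventually_map.2 ?_⟩
  filter_upwards [eventually_gt_atTop 0] with n hn
  obtain ⟨m, rfl⟩ := Nat.exists_eq_succ_of_ne_zero hn.ne'
  obtain ⟨q, hq0, hqm, hq⟩ := exists_path_of_calibrated hz 0 m
  obtain ⟨r, hr0, hrn, hr⟩ := exists_path_append c
    (p := fun i => if i = 0 then x else z (0 + m)) (q := q) (m := 1) (n := m) (by simp [hq0])
  have h1 := chainCost_le_pathCost hc r (1 + m)
  rw [hr, hr0, hrn, hqm, hq, hz0] at h1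
  have h2 := (abs_le.1 (hM (x, z (0 + m)))).2
  have h3 := (abs_le.1 (hK y)).2
  have h4 := (abs_le.1 (hK (z (0 + m)))).1
  rw [Nat.succ_eq_add_one, add_comm m 1]
  simp only [pathCost, Finset.sum_range_one, if_true, zero_add, one_ne_zero, if_false,
    Function.uncurry] at h1 h2 h3 h4 ⊢
  linarith

lemma exists_path_lt_of_peierlsBarrier_lt (hc : Continuous (Function.uncurry c)) {x y : X}
    {a : ℝ} (h : peierlsBarrier c x y < a) (N : ℕ) :
    ∃ n, N ≤ n ∧ 0 < n ∧ ∃ p : ℕ → X, p 0 = x ∧ p n = y ∧ pathCost c p n < a := by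
  obtain ⟨n, hn, hlt⟩ := frequently_atTop.1
    (frequently_lt_of_liminf_lt (isCoboundedUnder_ge_chainCost hc x y) h) (N + 1)
  exact ⟨n, by omega, by omega, exists_pathCost_lt (by omega) hlt⟩

lemma peierlsBarrier_le_of_paths (hc : Continuous (Function.uncurry c)) {x y : X} {a : ℝ}
    (h : ∀ ε > 0, ∀ N : ℕ, ∃ n, N ≤ n ∧ ∃ p : ℕ → X, p 0 = x ∧ p n = y ∧
      pathCost c p n ≤ a + ε) : peierlsBarrier c x y ≤ a := by
  refine le_of_forall_pos_le_add fun ε hε => ?_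
  refine liminf_le_of_frequently_le (frequently_atTop.2 fun N => ?_)
    (isBoundedUnder_ge_chainCost hc x y)
  obtain ⟨n, hn, p, rfl, rfl, hp⟩ := h ε hε N
  exact ⟨n, hn, (chainCost_le_pathCost hc p n).trans hp⟩

lemma IsCriticalSubsolution.sub_le_peierlsBarrier (hc : Continuous (Function.uncurry c))
    {u : X → ℝ} (hu : IsCriticalSubsolution c u) (x y : X) : u y - u x ≤ peierlsBarrier c x y := by
  refine le_liminf_of_le (isCoboundedUnder_ge_chainCost hc x y) ?_
  filter_upwards [eventually_gt_atTop 0] with n hn using hu.sub_le_chainCost hn x y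

lemma peierlsBarrier_triangle (hc : Continuous (Function.uncurry c)) (x y z : X) :
    peierlsBarrier c x z ≤ peierlsBarrier c x y + peierlsBarrier c y z := by
  refine peierlsBarrier_le_of_paths hc fun ε hε N => ?_
  obtain ⟨m, hm, -, p, hp0, hpm, hp⟩ := exists_path_lt_of_peierlsBarrier_lt hc
    (lt_add_of_pos_right (peierlsBarrier c x y) (half_pos hε)) N
  obtain ⟨n, hn, -, q, hq0, hqn, hq⟩ := exists_path_lt_of_peierlsBarrier_lt hc
    (lt_add_of_pos_right (peierlsBarrier c y z) (half_pos hε)) N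
  obtain ⟨r, hr0, hrn, hr⟩ := exists_path_append c (m := m) (n := n) (hpm.trans hq0.symm)
  exact ⟨m + n, by omega, r, hr0.trans hp0, hrn.trans hqn, by linarith⟩

/-- This makes `-h (·, z)` a critical subsolution. -/
lemma peierlsBarrier_le_cost_add (hc : Continuous (Function.uncurry c)) (x y z : X) :
    peierlsBarrier c x z ≤ c x y + criticalValue c + peierlsBarrier c y z := by
  refine peierlsBarrier_le_of_paths hc fun ε hε N => ?_
  obtain ⟨n, hn, -, q, hq0, hqn, hq⟩ := exists_path_lt_of_peierlsBarrier_lt hc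
    (lt_add_of_pos_right (peierlsBarrier c y z) hε) N
  obtain ⟨r, hr0, hrn, hr⟩ := exists_path_append c (p := fun i => if i = 0 then x else y)
    (m := 1) (n := n) (by simpa using hq0.symm)
  refine ⟨1 + n, by omega, r, by simpa using hr0, hrn.trans hqn, ?_⟩
  have : pathCost c (fun i => if i = 0 then x else y) 1 = c x y + criticalValue c := by
    simp [pathCost]
  linarith

lemma exists_peierlsBarrier_le_left (hc : Continuous (Function.uncurry c)) {ε : ℝ} (hε : 0 < ε) :
    ∃ δ > 0, ∀ x x' : X, dist x x' < δ →
      ∀ y, peierlsBarrier c x y ≤ peierlsBarrier c x' y + ε := by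
  obtain ⟨δ, hδ, h⟩ := exists_path_change_start hc hε
  refine ⟨δ, hδ, fun x x' hx y => peierlsBarrier_le_of_paths hc fun η hη N => ?_⟩
  obtain ⟨n, hn, hn0, p, hp0, hpn, hp⟩ := exists_path_lt_of_peierlsBarrier_lt hc
    (lt_add_of_pos_right (peierlsBarrier c x' y) hη) N
  obtain ⟨q, hq0, hqn, hq⟩ := h x x' hx p n hn0 hp0
  exact ⟨n, hn, q, hq0, hqn.trans hpn, by linarith⟩

lemma exists_peierlsBarrier_le_right (hc : Continuous (Function.uncurry c)) {ε : ℝ} (hε : 0 < ε) :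
    ∃ δ > 0, ∀ y y' : X, dist y y' < δ →
      ∀ x, peierlsBarrier c x y ≤ peierlsBarrier c x y' + ε := by
  obtain ⟨δ, hδ, h⟩ := exists_path_change_end hc hε
  refine ⟨δ, hδ, fun y y' hy x => peierlsBarrier_le_of_paths hc fun η hη N => ?_⟩
  obtain ⟨n, hn, hn0, p, hp0, hpn, hp⟩ := exists_path_lt_of_peierlsBarrier_lt hc
    (lt_add_of_pos_right (peierlsBarrier c x y') hη) N
  obtain ⟨q, hq0, hqn, hq⟩ := h y y' hy p n hn0 hpn
  exact ⟨n, hn, q, hq0.trans hp0, hqn, by linarith⟩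

lemma continuous_peierlsBarrier_left (hc : Continuous (Function.uncurry c)) (y : X) :
    Continuous fun x => peierlsBarrier c x y := by
  refine Metric.continuous_iff.2 fun x ε hε => ?_
  obtain ⟨δ, hδ, h⟩ := exists_peierlsBarrier_le_left hc (half_pos hε)
  refine ⟨δ, hδ, fun x' hx' => ?_⟩
  have h1 := h x' x hx' y
  have h2 := h x x' (by rwa [dist_comm]) y
  rw [Real.dist_eq, abs_lt]
  constructor <;> linarith

/-- A critical solution is reached from a point of the Aubry set. -/
theorem exists_aubry_point (hc : Continuous (Function.uncurry c)) {u : X → ℝ}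
    (hu : IsPerturbedSolution c 0 (criticalValue c) u) (x₀ : X) :
    ∃ y, peierlsBarrier c y y ≤ 0 ∧ u y + peierlsBarrier c y x₀ ≤ u x₀ := by
  obtain ⟨x, hx0, hx⟩ := exists_calibrated hu x₀
  -- The Aubry point is a limit of the backward calibrated chain from `x₀`; late points near `y` are
  -- moved to `y` at small cost.
  obtain ⟨y, -, hy⟩ := isCompact_univ.ultrafilter_le_nhds' ((hyperfilter ℕ).map x)
    Filter.univ_mem
  replace hy : Tendsto x (hyperfilter ℕ) (𝓝 y) := hy
  have huy : Tendsto (fun n => u (x n)) (hyperfilter ℕ) (𝓝 (u y)) :=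
    (hu.continuous.tendsto y).comp hy
  have key : ∀ i, peierlsBarrier c y (x i) ≤ u (x i) - u y := by
    intro i
    refine peierlsBarrier_le_of_paths hc fun ε hε N => ?_
    obtain ⟨δ, hδ, h⟩ := exists_path_change_start hc (half_pos hε)
    have hev : ∀ᶠ n : ℕ in hyperfilter ℕ, i + N + 1 ≤ n :=
      Nat.hyperfilter_le_atTop (eventually_ge_atTop _)
    obtain ⟨j, hj, hjy, hju⟩ := (hev.and ((Metric.tendsto_nhds.1 hy δ hδ).and
      (Metric.tendsto_nhds.1 huy (ε / 2) (half_pos hε)))).exists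
    obtain ⟨n, rfl⟩ := Nat.exists_eq_add_of_le (show i ≤ j by omega)
    obtain ⟨p, hp0, hpn, hp⟩ := exists_path_of_calibrated hx i n
    obtain ⟨q, hq0, hqn, hq⟩ := h y (x (i + n)) (by rwa [dist_comm]) p n (by omega) hp0
    refine ⟨n, by omega, q, hq0, hqn.trans hpn, ?_⟩
    rw [Real.dist_eq, abs_lt] at hju
    linarith [hju.1]
  refine ⟨y, ?_, ?_⟩
  · refine le_of_forall_pos_le_add fun ε hε => ?_
    obtain ⟨δ, hδ, h⟩ := exists_peierlsBarrier_le_right hc (half_pos hε)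
    obtain ⟨i, hiy, hiu⟩ := ((Metric.tendsto_nhds.1 hy δ hδ).and
      (Metric.tendsto_nhds.1 huy (ε / 2) (half_pos hε))).exists
    have h1 := h y (x i) (by rwa [dist_comm]) y
    have h2 := key i
    rw [Real.dist_eq, abs_lt] at hiu
    linarith [hiu.2]
  · have := key 0
    rw [hx0] at this
    linarith

end Peierls

/-! ### Representation of the limit by barrier averages. -/

section Representation

variable {X : Type*} [MetricSpace X] [CompactSpace X] [Nonempty X] [MeasurableSpace X]
  [BorelSpace X] {c : X → X → ℝ} {α : X → ℝ}

/-- The weighted average of the Peierls barrier occurring in the representation formula. -/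
noncomputable def barrierAverage (c : X → X → ℝ) (α : X → ℝ) (μ : Measure (X × X)) (x₀ : X) : ℝ :=
  (∫ x, α x * peierlsBarrier c x x₀ ∂(μ.map Prod.fst)) / (∫ x, α x ∂(μ.map Prod.fst))

lemma barrierAverage_eq (hc : Continuous (Function.uncurry c)) (hα : Continuous α)
    (μ : Measure (X × X)) (x₀ : X) :
    barrierAverage c α μ x₀ =
      (∫ p, α p.1 * peierlsBarrier c p.1 x₀ ∂μ) / ∫ p, α p.1 ∂μ := by
  rw [barrierAverage, integral_map_fst μ hα,
    integral_map_fst μ (f := fun x => α x * peierlsBarrier c x x₀)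
      (hα.mul (continuous_peierlsBarrier_left hc x₀))]

/-- Average `u x₀ - u x ≤ h (x, x₀)` with weight `α` and drop `∫ α u ≤ 0`. -/
lemma le_barrierAverage (hc : Continuous (Function.uncurry c))
    (hα : Continuous α) (hα1 : ∀ x, α x ∈ Set.Ico (0 : ℝ) 1)
    (hα_pos : ∀ μ : Measure (X × X), IsMatherMeasure c μ → 0 < ∫ x, α x ∂(μ.map Prod.fst))
    {u : X → ℝ} (hu : u ∈ constrainedSubsolutions c α) {μ : Measure (X × X)}
    (hμ : IsMatherMeasure c μ) (x₀ : X) : u x₀ ≤ barrierAverage c α μ x₀ := by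
  obtain ⟨huc, husub, huint⟩ := hu
  have hpos := hα_pos μ hμ
  have hle := huint μ hμ
  have hh := continuous_peierlsBarrier_left hc x₀
  have := hμ.1.1
  rw [integral_map_fst μ hα] at hpos
  rw [integral_map_fst μ (f := fun x => α x * u x) (by fun_prop)] at hle
  rw [barrierAverage_eq hc hα, le_div_iff₀ hpos, ← integral_const_mul]
  have i1 : Integrable (fun p : X × X => α p.1 * peierlsBarrier c p.1 x₀) μ :=
    integrable_of_continuous μ ((hα.mul hh).comp continuous_fst)
  have i2 : Integrable (fun p : X × X => α p.1 * u p.1) μ :=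
    integrable_of_continuous μ (by fun_prop)
  calc ∫ p, u x₀ * α p.1 ∂μ
      ≤ ∫ p, (α p.1 * peierlsBarrier c p.1 x₀ + α p.1 * u p.1) ∂μ := by
        refine integral_mono (integrable_of_continuous μ (by fun_prop)) (i1.add i2) fun p => ?_
        have h1 := husub.sub_le_peierlsBarrier hc p.1 x₀
        have h2 := mul_le_mul_of_nonneg_left h1 (hα1 p.1).1
        simp only
        linarith
    _ = ∫ p, α p.1 * peierlsBarrier c p.1 x₀ ∂μ + ∫ p, α p.1 * u p.1 ∂μ := integral_add i1 i2
    _ ≤ _ := by linarith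

lemma barrierAverage_le_add (hc : Continuous (Function.uncurry c))
    (hα : Continuous α) (hα1 : ∀ x, α x ∈ Set.Ico (0 : ℝ) 1)
    (hα_pos : ∀ μ : Measure (X × X), IsMatherMeasure c μ → 0 < ∫ x, α x ∂(μ.map Prod.fst))
    {μ : Measure (X × X)} (hμ : IsMatherMeasure c μ) (x₀ y : X) :
    barrierAverage c α μ x₀ ≤ barrierAverage c α μ y + peierlsBarrier c y x₀ := by
  have hpos := hα_pos μ hμ
  have := hμ.1.1
  rw [integral_map_fst μ hα] at hpos
  have i : ∀ z, Integrable (fun p : X × X => α p.1 * peierlsBarrier c p.1 z) μ := fun z =>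
    integrable_of_continuous μ
      ((hα.mul (continuous_peierlsBarrier_left hc z)).comp continuous_fst)
  have iα : Integrable (fun p : X × X => α p.1) μ := integrable_of_continuous μ (by fun_prop)
  rw [barrierAverage_eq hc hα, barrierAverage_eq hc hα, div_add' _ _ _ hpos.ne',
    div_le_div_iff_of_pos_right hpos, ← integral_const_mul,
    ← integral_add (i y) (iα.const_mul _)]
  refine integral_mono (i x₀) ((i y).add (iα.const_mul _)) fun p => ?_
  have h := mul_le_mul_of_nonneg_left (peierlsBarrier_triangle hc p.1 y x₀) (hα1 p.1).1
  simp only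
  linarith

/-- The barrier average is minimized by some Mather measure. -/
lemma exists_barrierAverage_le (hc : Continuous (Function.uncurry c))
    (hα : Continuous α) (hα1 : ∀ x, α x ∈ Set.Ico (0 : ℝ) 1)
    (hα_pos : ∀ μ : Measure (X × X), IsMatherMeasure c μ → 0 < ∫ x, α x ∂(μ.map Prod.fst))
    (x₀ : X) : ∃ μ, IsMatherMeasure c μ ∧
      ∀ ν, IsMatherMeasure c ν → barrierAverage c α μ x₀ ≤ barrierAverage c α ν x₀ := by
  set S : Set ℝ := {r | ∃ μ, IsMatherMeasure c μ ∧ r = barrierAverage c α μ x₀} with hS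
  have hne : S.Nonempty := by
    obtain ⟨μ, hμ⟩ := exists_isMatherMeasure hc
    exact ⟨_, μ, hμ, rfl⟩
  -- Any element of `F_α` bounds the averages below; the limit function provides one.
  obtain ⟨v, -, hv, -⟩ := exists_tendstoUniformly_discounted hc hα hα1 hα_pos
  have hbdd : BddBelow S := by
    refine ⟨v x₀, ?_⟩
    rintro _ ⟨μ, hμ, rfl⟩
    exact le_barrierAverage hc hα hα1 hα_pos hv hμ x₀
  obtain ⟨r, -, hr, hrS⟩ := exists_seq_tendsto_sInf hne hbdd
  choose μ hμ hrμ using hrS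
  obtain ⟨ν, hν, hlim⟩ := exists_isMatherMeasure_tendsto hc (hyperfilter ℕ) hμ
  refine ⟨ν, hν, fun ν' hν' => ?_⟩
  have hpos := hα_pos ν hν
  rw [integral_map_fst ν hα] at hpos
  have h1 : Tendsto (fun n => barrierAverage c α (μ n) x₀) (hyperfilter ℕ)
      (𝓝 (barrierAverage c α ν x₀)) := by
    simp only [barrierAverage_eq hc hα]
    exact (hlim _ ((hα.mul (continuous_peierlsBarrier_left hc x₀)).comp continuous_fst)).div
      (hlim _ (hα.comp continuous_fst)) hpos.ne'
  have h2 : sInf S = barrierAverage c α ν x₀ := by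
    refine tendsto_nhds_unique (hr.mono_left Nat.hyperfilter_le_atTop) (h1.congr fun n => ?_)
    exact (hrμ n).symm
  rw [← h2]
  exact csInf_le hbdd ⟨ν', hν', rfl⟩

/-- The barrier, suitably normalized, is a constrained subsolution in its first variable. -/
lemma sub_peierlsBarrier_mem_constrainedSubsolutions (hc : Continuous (Function.uncurry c))
    (hα : Continuous α)
    (hα_pos : ∀ μ : Measure (X × X), IsMatherMeasure c μ → 0 < ∫ x, α x ∂(μ.map Prod.fst))
    {y : X} {r : ℝ} (hr : ∀ μ, IsMatherMeasure c μ → r ≤ barrierAverage c α μ y) :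
    (fun x => r - peierlsBarrier c x y) ∈ constrainedSubsolutions c α := by
  have hh := continuous_peierlsBarrier_left hc y
  refine ⟨continuous_const.sub hh, fun a b => ?_, fun μ hμ => ?_⟩
  · have := peierlsBarrier_le_cost_add hc a b y
    linarith
  · have := hμ.1.1
    have hpos := hα_pos μ hμ
    have h := hr μ hμ
    rw [integral_map_fst μ hα] at hpos
    rw [barrierAverage_eq hc hα, le_div_iff₀ hpos] at h
    rw [integral_map_fst μ (f := fun x => α x * (r - peierlsBarrier c x y))
      (hα.mul (continuous_const.sub hh))]
    have i1 : Integrable (fun p : X × X => α p.1 * peierlsBarrier c p.1 y) μ :=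
      integrable_of_continuous μ ((hα.mul hh).comp continuous_fst)
    have i2 : Integrable (fun p : X × X => α p.1 * r) μ :=
      integrable_of_continuous μ (by fun_prop)
    simp only [mul_sub]
    rw [integral_sub i2 i1, integral_mul_const]
    linarith

end Representation

end DiscreteWeakKAM

theorem mainTheorem2 {X : Type*} [MetricSpace X] [CompactSpace X] [Nonempty X]
    [MeasurableSpace X] [BorelSpace X]
    (c : X → X → ℝ) (hc : Continuous (Function.uncurry c))
    (α : X → ℝ) (hα : Continuous α) (hα_range : ∀ x, α x ∈ Set.Ico (0 : ℝ) 1)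
    (hα_pos : ∀ μ : Measure (X × X), DiscreteWeakKAM.IsMatherMeasure c μ →
      0 < ∫ x, α x ∂(μ.map Prod.fst)) :
    (∀ lam ∈ Set.Ioo (0 : ℝ) 1, ∃! u : X → ℝ, DiscreteWeakKAM.IsDiscountedSolution c α lam u) ∧
    ∃ u₀ : X → ℝ,
      (∀ u : ℝ → X → ℝ,
        (∀ lam ∈ Set.Ioo (0 : ℝ) 1, DiscreteWeakKAM.IsDiscountedSolution c α lam (u lam)) →
        TendstoUniformly u u₀ (𝓝[>] (0 : ℝ))) ∧
      (∀ x₀ : X,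
        IsGreatest {r : ℝ | ∃ u ∈ DiscreteWeakKAM.constrainedSubsolutions c α, r = u x₀}
          (u₀ x₀)) ∧
      (∀ x₀ : X,
        IsLeast {r : ℝ | ∃ μ : Measure (X × X), DiscreteWeakKAM.IsMatherMeasure c μ ∧
            r = (∫ x, α x * DiscreteWeakKAM.peierlsBarrier c x x₀ ∂(μ.map Prod.fst)) /
              (∫ x, α x ∂(μ.map Prod.fst))}
          (u₀ x₀)) := by

  open DiscreteWeakKAM in
  refine ⟨fun lam hlam => ?_, ?_⟩
  · obtain ⟨K, hK⟩ := exists_discounted_solution hc hα hα_range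
    obtain ⟨u, hu, -⟩ := hK lam hlam
    exact ⟨u, hu.isDiscountedSolution, fun v hv =>
      hv.unique hc hα hα_range hα_pos hlam hu.isDiscountedSolution⟩
  · obtain ⟨u₀, hu₀, hF, hmax, hconv⟩ :=
      exists_tendstoUniformly_discounted hc hα hα_range hα_pos
    refine ⟨u₀, hconv, fun x₀ => ⟨⟨u₀, hF, rfl⟩, ?_⟩, fun x₀ => ⟨?_, ?_⟩⟩
    · rintro _ ⟨w, hw, rfl⟩
      exact hmax w hw x₀
    · obtain ⟨μ, hμ, hμmin⟩ := exists_barrierAverage_le hc hα hα_range hα_pos x₀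
      refine ⟨μ, hμ, le_antisymm (le_barrierAverage hc hα hα_range hα_pos hF hμ x₀) ?_⟩
      -- With `ν` minimizing at `y`, the chain is: average of `μ` at `x₀` ≤ average of `ν` at `x₀` ≤
      -- average of `ν` at `y` plus `h (y, x₀)` ≤ `u₀ y + h (y, y) + h (y, x₀)` ≤ `u₀ x₀`, the last
      -- step using `h (y, y) ≤ 0`.
      obtain ⟨y, hyy, hy⟩ := exists_aubry_point hc hu₀ x₀
      obtain ⟨ν, hν, hνmin⟩ := exists_barrierAverage_le hc hα hα_range hα_pos y
      have h1 : barrierAverage c α ν y - peierlsBarrier c y y ≤ u₀ y :=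
        hmax _ (sub_peierlsBarrier_mem_constrainedSubsolutions hc hα hα_pos hνmin) y
      have h2 := barrierAverage_le_add hc hα hα_range hα_pos hν x₀ y
      have h3 := hμmin ν hν
      simp only [barrierAverage] at h1 h2 h3 ⊢
      linarith
    · rintro _ ⟨μ, hμ, rfl⟩
      exact le_barrierAverage hc hα hα_range hα_pos hF hμ x₀
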